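/- Let $d,n\ge 1$, index vectors of $\mathbb R^d$ by $\mathbb Z/d$, and let $[\mathcal F(v)]_k=\frac1{\sqrt d}\sum_{l=0}^{d-1}[v]_l e^{-2\pi \mathrm i kl/d}$ be the unitary discrete Fourier transform. For $w,x\in\mathbb R^d$ let $[w\star x]_i=\frac1{\sqrt d}\sum_{k\in\mathbb Z/d}[w]_{-k}[x]_{i+k}$ be circular convolution. For parameters $W=(w_1,w_2)\in\mathbb R^d\times\mathbb R^d$, the two-layer linear convolutional network is $\varphi(x;W)=w_2^\top(w_1\star x)$. It is linear in $x$; let $\beta(W)\in\mathbb R^d$ be the vector with $\varphi(x;W)=\langle\beta(W),x\rangle$ for all $x$. A dataset $(x_i,y_i)_{i=1}^n$ with $x_i\in\mathbb R^d$, $y_i\in\{-1,+1\}$ is linearly separable if there are $w\in\mathbb R^d$, $b\in\mathbb R$ with $y_i(\langle w,x_i\rangle+b)>0$ for all $i$. Its empirical risk with the exponential loss is $\mathcal L(W)=\frac1n\sum_i e^{-y_i\varphi(x_i;W)}$ as a function of the parameters, and $\mathcal R(\beta)=\frac1n\sum_i e^{-y_i\langle\beta,x_i\rangle}$ as a function of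 the linear predictor. For a function $\phi:\mathbb R^d\to\mathbb R$ let its robustness radius be $$\rho(\phi)=\sup\{\varepsilon\ge 0 : y_i\,\phi(x_i+\delta)>0\ \text{ for all } i \text{ and all } \delta\in\mathbb R^d \text{ with } \|\mathcal F(\delta)\|_\infty\le\varepsilon\}\in[0,\infty]$$ ($\sup\emptyset=0$). A maximally robust classifier is a function $\phi$ of the form $\varphi(\cdot\,;W)$ with $y_i\phi(x_i)>0$ for all $i$ and $\rho(\phi)\ge\rho(\varphi(\cdot\,;W'))$ for all $W'\in\mathbb R^d\times\mathbb R^d$. A sequence $u_t$ converges in direction to $u$ if $u_t/\|u_t\|_2\to u$. **Statement.** Fix labels $y\in\{-1,+1\}^n$. For Lebesgue-almost all $(x_i)_{i=1}^n\in(\mathbb R^d)^n$ for which the dataset is linearly separable, and for Lebesgue-almost all initializations $W_0\in\mathbb R^d\times\mathbb R^d$, the following holds. Let $W_{t+1}=W_t-\eta_t\nabla\mathcal L(W_t)$, $t\ge0$, be gradient descent iterates whose step sizes satisfy, for every $t$, $\eta_t>0$ and $\eta_tK_t<1$ for some $K_t$ that is a Lipschitz constant of $\nabla\mathcal L$ on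 a neighbourhood of $W_t$. Suppose that (a) $\mathcal L(W_t)\to0$; (b) the parameters $W_t$ converge in direction to some $W_\infty$ that separates the data with positive margin, $y_i\varphi(x_i;W_\infty)>0$ for all $i$; (c) the gradients $\nabla\mathcal R(\beta(W_t))$ with respect to the linear predictor converge in direction. Then the limit $\varphi(\cdot\,;W_\infty)$ is a maximally robust classifier; moreover the linear predictors $\beta(W_t)$ converge in direction to some $v\in\mathbb R^d$, and $x\mapsto\langle v,x\rangle$ is a maximally robust classifier. That is, the iterates converge in direction to a classifier, among all two-layer linear convolutional networks, that is maximally robust against perturbations $\delta$ with $\|\mathcal F(\delta)\|_\infty\le\varepsilon$. -/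

import Mathlib

open Filter Topology MeasureTheory
open scoped NNReal ENNReal

noncomputable section

namespace ConvNet

/-- Real signals of length `d`, indexed by residues modulo `d`, with the Euclidean norm. -/
abbrev Vec (d : ℕ) := EuclideanSpace ℝ (ZMod d)

/-- The parameters of a two-layer network: the convolution weights (layer `0`) and the weights of
the final linear layer (layer `1`), jointly a point of `ℝ ^ (2 d)` with the Euclidean norm. -/
abbrev Params (d : ℕ) := EuclideanSpace ℝ (Fin 2 × ZMod d)

/-- The weight vector of one layer. -/
def layer {d : ℕ} (W : Params d) (l : Fin 2) : Vec d :=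
  WithLp.toLp 2 fun k => W (l, k)

/-- Normalized circular convolution. -/
def circConv {d : ℕ} [NeZero d] (w x : Vec d) : Vec d :=
  WithLp.toLp 2 fun i => (1 / √(d : ℝ)) * ∑ k : ZMod d, w (-k) * x (i + k)

/-- The function computed by the two-layer linear convolutional network. -/
def convNet {d : ℕ} [NeZero d] (W : Params d) (x : Vec d) : ℝ :=
  inner ℝ (layer W 1) (circConv (layer W 0) x)

/-- The family of all functions computed by two-layer linear convolutional networks. -/
def convNets (d : ℕ) [NeZero d] : Set (Vec d → ℝ) :=
  Set.range (convNet (d := d))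

/-- The weights of the linear model that the network is equivalent to, see
`convNet_eq_inner_predictor`. -/
def predictor {d : ℕ} [NeZero d] (W : Params d) : Vec d :=
  WithLp.toLp 2 fun j => (1 / √(d : ℝ)) * ∑ i : ZMod d, layer W 1 i * layer W 0 (i - j)

theorem convNet_eq_inner_predictor {d : ℕ} [NeZero d] (W : Params d) (x : Vec d) :
    convNet W x = inner ℝ (predictor W) x := by
  simp only [convNet, predictor, circConv, PiLp.inner_apply, RCLike.inner_apply, conj_trivial,
    Finset.mul_sum, Finset.sum_mul]
  rw [Finset.sum_comm]
  conv_rhs => rw [Finset.sum_comm]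
  rw [Finset.sum_comm]
  refine Finset.sum_congr rfl fun i _ => ?_
  refine Fintype.sum_equiv (Equiv.addLeft i) _ _ fun k => ?_
  simp only [Equiv.coe_addLeft, sub_add_cancel_left]
  ring

/-- The unitary discrete Fourier transform of a real signal. `ZMod.dft` is the unnormalized
transform, `k ↦ ∑ l, exp (-2 π i k l / d) * v l`. The norm of the value, in `ZMod d → ℂ`, is the
`ℓ_∞` norm. -/
def fourier {d : ℕ} [NeZero d] (v : Vec d) : ZMod d → ℂ :=
  ((1 / √(d : ℝ) : ℝ) : ℂ) • ZMod.dft (fun k => (v k : ℂ))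

/-- Linear separability of a data set with labels `±1`. -/
def LinearlySeparable {d n : ℕ} [NeZero d] (x : Fin n → Vec d) (y : Fin n → ℝ) : Prop :=
  ∃ (w : Vec d) (b : ℝ), ∀ i, 0 < y i * (inner ℝ w (x i) + b)

/-- The empirical risk of a network, with the exponential loss. -/
def netRisk {d n : ℕ} [NeZero d] (x : Fin n → Vec d) (y : Fin n → ℝ) (W : Params d) : ℝ :=
  (1 / (n : ℝ)) * ∑ i, Real.exp (-(y i * convNet W (x i)))

/-- The empirical risk of a linear model, with the exponential loss. -/
def linRisk {d n : ℕ} [NeZero d] (x : Fin n → Vec d) (y : Fin n → ℝ) (β : Vec d) : ℝ :=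
  (1 / (n : ℝ)) * ∑ i, Real.exp (-(y i * inner ℝ β (x i)))

/-- `W` is a sequence of gradient descent iterates for `f` with step sizes `η`. -/
def IsGradientDescent {d : ℕ} [NeZero d] (f : Params d → ℝ) (η : ℕ → ℝ) (W : ℕ → Params d) :
    Prop :=
  ∀ t, W (t + 1) = W t - η t • gradient f (W t)

/-- The step size `s` at the point `W` is positive and smaller than the inverse of a local
Lipschitz constant of the gradient of `f` at `W`. -/
def IsAdmissibleStep {d : ℕ} [NeZero d] (f : Params d → ℝ) (s : ℝ) (W : Params d) : Prop :=
  0 < s ∧ ∃ K : ℝ≥0, (∃ U ∈ 𝓝 W, LipschitzOnWith K (gradient f) U) ∧ s * K < 1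

/-- The sequence `v` converges in direction to `u`. -/
def TendstoInDirection {E : Type*} [NormedAddCommGroup E] [NormedSpace ℝ E]
    (v : ℕ → E) (u : E) : Prop :=
  Tendsto (fun t => ‖v t‖⁻¹ • v t) atTop (𝓝 u)

/-- `φ` classifies every data point correctly under all perturbations whose Fourier coefficients
are bounded by `ε`. -/
def IsRobust {d n : ℕ} [NeZero d] (x : Fin n → Vec d) (y : Fin n → ℝ) (φ : Vec d → ℝ)
    (ε : ℝ≥0) : Prop :=
  ∀ i, ∀ δ : Vec d, ‖fourier δ‖ ≤ ε → 0 < y i * φ (x i + δ)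

/-- The supremum of the `ε ≥ 0` such that `φ` is robust with bound `ε`. -/
def robustRadius {d n : ℕ} [NeZero d] (x : Fin n → Vec d) (y : Fin n → ℝ) (φ : Vec d → ℝ) :
    ℝ≥0∞ :=
  ⨆ (ε : ℝ≥0) (_ : IsRobust x y φ ε), (ε : ℝ≥0∞)

/-- `φ` is a maximally robust classifier in the family `Φ`, for the Fourier-`ℓ_∞` norm. -/
structure IsMaximallyRobust {d n : ℕ} [NeZero d] (Φ : Set (Vec d → ℝ)) (x : Fin n → Vec d)
    (y : Fin n → ℝ) (φ : Vec d → ℝ) : Prop where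
  /-- The classifier belongs to the family. -/
  mem : φ ∈ Φ
  /-- It is feasible: it classifies the data correctly, that is, it is robust with bound `0`. -/
  correct : ∀ i, 0 < y i * φ (x i)
  /-- No classifier of the family has a larger robustness radius. -/
  le_radius : ∀ ψ ∈ Φ, robustRadius x y ψ ≤ robustRadius x y φ

end ConvNet

end

/-!
Maximal robustness against `‖fourier δ‖ ≤ ε` is, by duality, a problem of margin maximization under a
bound on the `ℓ₁` norm of the Fourier transform of the predictor, which is convex. So it suffices to
show that the limit direction satisfies its first-order optimality conditions.

Let `M z = couplingOp z` be the symmetric operator on the parameters with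
`⟪W, M z W⟫ = 2 * convNet W z`. The gradient of the risk at `W t` is `-M (r t) (W t)`, where the residual
`r t` is the negative gradient of the risk with respect to the linear predictor. Let `u` and `z` be
the limit directions of `W t` and `r t`.

* A Stolz–Cesàro argument gives `M z u = l • u` with `l = ‖M z u‖`
  (`eq_norm_smul_of_tendstoInDirection`).
* The Fourier transform splits `M z` into blocks with eigenvalues `±‖fourier z k‖`, and
  `‖fourier z k‖ ≤ l` for all `k` (`exists_couplingOp_eq_smul`). Indeed, the step at the frequency `k`
  is a multiple of an element of `SU(1, 1)`, because admissible steps are smaller than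
  `1 / ‖fourier (r t) k‖` (`IsAdmissibleStep.mul_norm_fourier_lt_one`). It therefore preserves the
  condition that the two layers have different amplitudes at `k`, which holds for almost all
  initializations (`ae_norm_fourier_layer_ne`). Such a pair of amplitudes cannot converge to the
  contracting direction of the block, whatever the step sizes are, and ends up growing at the rate
  `‖fourier z k‖` (`exists_growth_of_norm_ne`), while `‖W t‖` grows at the rate `l`.
* The limit `z` is a nonnegative combination of the signed support vectors of `u`
  (`exists_eq_sum_support`), since with `‖W t‖ → ∞` the exponential loss of the other data points
  becomes negligible.

These three facts form a dual certificate for the maximal robustness of `u`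
(`isMaximallyRobust_of_certificate`).
-/

namespace ConvNet

/-! ### Growth along a divergent series of step sizes -/

/-- A positive sequence with relative growth at least `κ * τ t` in step `t`, where `∑ τ t`
diverges, is unbounded. -/
theorem exists_lt_of_growth {x τ : ℕ → ℝ} (hτ : ∀ t, 0 ≤ τ t)
    (hsum : Tendsto (fun n => ∑ t ∈ Finset.range n, τ t) atTop atTop) {κ : ℝ} (hκ : 0 < κ) {T : ℕ}
    (hT : 0 < x T) (hx : ∀ t ≥ T, (1 + κ * τ t) * x t ≤ x (t + 1)) (C : ℝ) :
    ∃ t ≥ T, C < x t := by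
  have key : ∀ t ≥ T, x T ≤ x t ∧ x T * (1 + κ * (∑ s ∈ Finset.range t, τ s
      - ∑ s ∈ Finset.range T, τ s)) ≤ x t := by
    intro t ht
    induction t, ht using Nat.le_induction with
    | base => simp
    | succ t ht ih =>
      have h1 := hx t ht
      have h2 : 0 ≤ κ * τ t := mul_nonneg hκ.le (hτ t)
      have h3 : κ * τ t * x T ≤ κ * τ t * x t := mul_le_mul_of_nonneg_left ih.1 h2
      have h4 : 0 ≤ κ * τ t * x T := mul_nonneg h2 hT.le
      rw [Finset.sum_range_succ]
      constructor
      · linarith [ih.1]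
      · linarith [ih.2]
  obtain ⟨t, h1, h2⟩ := ((hsum.eventually_gt_atTop
    (C / x T / κ + ∑ s ∈ Finset.range T, τ s)).and (eventually_ge_atTop T)).exists
  refine ⟨t, h2, lt_of_lt_of_le ?_ (key t h2).2⟩
  have h3 : C / x T / κ < ∑ s ∈ Finset.range t, τ s - ∑ s ∈ Finset.range T, τ s := by linarith
  rw [div_lt_iff₀ hκ, div_lt_iff₀ hT] at h3
  linarith

/-- If a sequence with relative growth at most `C * τ t` in step `t` tends to infinity, then
`∑ τ t` diverges. -/
theorem tendsto_sum_of_growth {x τ : ℕ → ℝ} (hτ : ∀ t, 0 ≤ τ t) {C : ℝ} (hC : 0 ≤ C)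
    (hx0 : ∀ t, 0 ≤ x t) (hx : ∀ t, x (t + 1) ≤ (1 + τ t * C) * x t)
    (htop : Tendsto x atTop atTop) :
    Tendsto (fun n => ∑ t ∈ Finset.range n, τ t) atTop atTop := by
  have key : ∀ t, x t ≤ x 0 * Real.exp (C * ∑ s ∈ Finset.range t, τ s) := by
    intro t
    induction t with
    | zero => simp
    | succ t ih =>
      rw [Finset.sum_range_succ, mul_add, Real.exp_add]
      have h1 : 1 + τ t * C ≤ Real.exp (C * τ t) := by
        have := Real.add_one_le_exp (C * τ t)
        linarith
      calc x (t + 1) ≤ (1 + τ t * C) * x t := hx t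
        _ ≤ Real.exp (C * τ t) * (x 0 * Real.exp (C * ∑ s ∈ Finset.range t, τ s)) :=
            mul_le_mul h1 ih (hx0 t) (Real.exp_pos _).le
        _ = _ := by ring
  refine tendsto_atTop_atTop_of_monotone
    (monotone_nat_of_le_succ fun t => by rw [Finset.sum_range_succ]; linarith [hτ t]) ?_
  by_contra! hcon
  obtain ⟨B, hB⟩ := hcon
  obtain ⟨t, ht⟩ := (htop.eventually_gt_atTop (x 0 * Real.exp (C * B))).exists
  have h2 : Real.exp (C * ∑ s ∈ Finset.range t, τ s) ≤ Real.exp (C * B) :=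
    Real.exp_le_exp.2 (mul_le_mul_of_nonneg_left (hB t).le hC)
  linarith [key t, mul_le_mul_of_nonneg_left h2 (hx0 0)]

/-! ### The dynamics of a single frequency -/

open ComplexConjugate in
/-- The pair `(b, a)` is multiplied by `1 + τ * [[0, ω], [conj ω, 0]]`, which for `τ * ‖ω‖ < 1` is a
multiple of an element of `SU(1, 1)`, and `ω` tends to `c > 0`. If initially `‖b‖ ≠ ‖a‖`, then the
component `b + a` along the expanding direction eventually grows at every rate `κ < c`.

The quantity `‖b‖ ^ 2 - ‖a‖ ^ 2` is multiplied by `1 - (τ * ‖ω‖) ^ 2` in each step and stays nonzero.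
With `p = b + a` and `q = b - a` it is at most `‖p‖ * ‖q‖`, and as long as `‖p‖ < ‖q‖`, its ratio to
`‖q‖ ^ 2` grows; so the iterates enter the cone `‖q‖ ≤ ‖p‖`, which they do not leave. -/
theorem exists_growth_of_norm_ne {a b ω : ℕ → ℂ} {τ : ℕ → ℝ} {c κ : ℝ}
    (hτ : ∀ t, 0 < τ t) (hb : ∀ t, b (t + 1) = b t + τ t * (ω t * a t))
    (ha : ∀ t, a (t + 1) = a t + τ t * (conj (ω t) * b t))
    (hω : Tendsto ω atTop (𝓝 (c : ℂ))) (hlt : ∀ t, τ t * ‖ω t‖ < 1) (h0 : ‖b 0‖ ≠ ‖a 0‖)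
    (hsum : Tendsto (fun n => ∑ t ∈ Finset.range n, τ t) atTop atTop) (hκ : 0 < κ) (hκc : κ < c) :
    ∃ T, 0 < ‖b T + a T‖ ∧ ∀ t ≥ T, (1 + κ * τ t) * ‖b t + a t‖ ≤ ‖b (t + 1) + a (t + 1)‖ := by
  set p : ℕ → ℂ := fun t => b t + a t with hp
  set q : ℕ → ℂ := fun t => b t - a t with hq
  set Δ : ℕ → ℝ := fun t => 1 - (τ t * ‖ω t‖) ^ 2 with hΔ
  set D : ℕ → ℝ := fun t => ‖b t‖ ^ 2 - ‖a t‖ ^ 2 with hD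
  have hΔ0 : ∀ t, 0 < Δ t := fun t => by
    have := hlt t
    have h2 : 0 ≤ τ t * ‖ω t‖ := mul_nonneg (hτ t).le (norm_nonneg _)
    simp only [hΔ]; nlinarith
  have hΔ1 : ∀ t, Δ t ≤ 1 := fun t => by simp only [hΔ]; linarith [sq_nonneg (τ t * ‖ω t‖)]
  have hDs : ∀ t, D (t + 1) = Δ t * D t := fun t => by
    simp only [hD, hΔ, mul_pow, ha, hb, ← Complex.normSq_eq_norm_sq, Complex.normSq_apply]
    simp
    ring
  have hD0 : ∀ t, D t ≠ 0 := fun t => by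
    induction t with
    | zero =>
      intro h
      exact h0 ((sq_eq_sq₀ (norm_nonneg _) (norm_nonneg _)).1 (sub_eq_zero.1 h))
    | succ t ih => rw [hDs]; exact mul_ne_zero (hΔ0 t).ne' ih
  have hDle : ∀ t, |D t| ≤ ‖p t‖ * ‖q t‖ := fun t => by
    have : D t = (p t * conj (q t)).re := by
      simp only [hD, hp, hq, ← Complex.normSq_eq_norm_sq, Complex.normSq_apply]
      simp
      ring
    rw [this]
    refine (Complex.abs_re_le_norm _).trans ?_
    simp
  have hps : ∀ t, p (t + 1) = (1 + τ t * (ω t).re) * p t - τ t * (ω t).im * Complex.I * q t :=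
    fun t => by
      simp only [hp, hq, ha, hb]
      apply Complex.ext <;> simp <;> ring
  have hqs : ∀ t, q (t + 1) = (1 - τ t * (ω t).re) * q t + τ t * (ω t).im * Complex.I * p t :=
    fun t => by
      simp only [hp, hq, ha, hb]
      apply Complex.ext <;> simp <;> ring
  -- the inverse of the step, from the adjugate matrix
  have hqi : ∀ t, (Δ t : ℂ) * q t
      = (1 + τ t * (ω t).re) * q (t + 1) - τ t * (ω t).im * Complex.I * p (t + 1) := fun t => by
    have : Δ t = 1 - τ t ^ 2 * ((ω t).re * (ω t).re + (ω t).im * (ω t).im) := by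
      simp only [hΔ, mul_pow, ← Complex.normSq_eq_norm_sq, Complex.normSq_apply]
    rw [hps, hqs, this]
    push_cast
    linear_combination (τ t ^ 2 * (ω t).im ^ 2 * q t) * (-Complex.I_sq)
  have hre : ∀ᶠ t in atTop, κ < (ω t).re - |(ω t).im| := by
    have h1 : Tendsto (fun t => (ω t).re - |(ω t).im|) atTop (𝓝 (c - |0|)) :=
      ((Complex.continuous_re.tendsto (c : ℂ)).comp hω).sub
        (((Complex.continuous_im.tendsto (c : ℂ)).comp hω).abs)
    exact h1.eventually_const_lt (by simpa using hκc)
  obtain ⟨T₀, hT₀⟩ := eventually_atTop.1 hre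
  have hn1 : ∀ t ≥ T₀, ‖(1 + τ t * (ω t).re : ℂ)‖ = 1 + τ t * (ω t).re := fun t ht => by
    have h1 : 0 ≤ (ω t).re := by linarith [hT₀ t ht, abs_nonneg (ω t).im]
    have h2 : 0 ≤ 1 + τ t * (ω t).re := by have := mul_nonneg (hτ t).le h1; linarith
    rw [← Complex.norm_of_nonneg h2]
    push_cast
    rfl
  have hn2 : ∀ t, ‖(τ t * (ω t).im * Complex.I : ℂ)‖ = τ t * |(ω t).im| := fun t => by
    simp [abs_of_pos (hτ t)]
  have hn3 : ∀ t ≥ T₀, ‖(1 - τ t * (ω t).re : ℂ)‖ = 1 - τ t * (ω t).re := fun t ht => by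
    have h1 : (ω t).re ≤ ‖ω t‖ := Complex.re_le_norm _
    have h2 : 0 ≤ 1 - τ t * (ω t).re := by
      have := mul_le_mul_of_nonneg_left h1 (hτ t).le
      linarith [hlt t]
    rw [← Complex.norm_of_nonneg h2]
    push_cast
    rfl
  -- the iterates enter the cone
  have hcone : ∃ T ≥ T₀, ‖q T‖ ≤ ‖p T‖ := by
    by_contra! hcon
    have hqpos : ∀ t ≥ T₀, 0 < ‖q t‖ := fun t ht => (norm_nonneg _).trans_lt (hcon t ht)
    have hgrow : ∀ t ≥ T₀, (1 + κ * τ t) * (|D t| / ‖q t‖ ^ 2) ≤ |D (t + 1)| / ‖q (t + 1)‖ ^ 2 := by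
      intro t ht
      have hτt := hτ t
      have h3 : (1 + κ * τ t) * ‖q (t + 1)‖ ≤ Δ t * ‖q t‖ := by
        have h4 : ‖(1 + τ t * (ω t).re : ℂ) * q (t + 1)‖
            - ‖(τ t * (ω t).im * Complex.I : ℂ) * p (t + 1)‖ ≤ ‖(Δ t : ℂ) * q t‖ := by
          rw [hqi]; exact norm_sub_norm_le _ _
        rw [norm_mul _ (q (t + 1)), norm_mul _ (p (t + 1)), norm_mul _ (q t), hn1 t ht, hn2,
          Complex.norm_of_nonneg (hΔ0 t).le] at h4
        have h5 := hcon (t + 1) (by omega)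
        have h6 := mul_le_mul_of_nonneg_left h5.le (mul_nonneg hτt.le (abs_nonneg (ω t).im))
        have h7 := mul_le_mul_of_nonneg_right (mul_le_mul_of_nonneg_left (hT₀ t ht).le hτt.le)
          (norm_nonneg (q (t + 1)))
        linarith
      have hq1 := hqpos t ht
      have hq2 := hqpos (t + 1) (by omega)
      rw [hDs, abs_mul, abs_of_pos (hΔ0 t), mul_div_assoc', div_le_div_iff₀ (by positivity)
        (by positivity)]
      have h8 : 0 < 1 + κ * τ t := by positivity
      have h9 : ((1 + κ * τ t) * ‖q (t + 1)‖) ^ 2 ≤ (Δ t * ‖q t‖) ^ 2 :=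
        pow_le_pow_left₀ (by positivity) h3 2
      have h10 : (1 + κ * τ t) * ‖q (t + 1)‖ ^ 2 ≤ ((1 + κ * τ t) * ‖q (t + 1)‖) ^ 2 := by
        rw [mul_pow]
        refine mul_le_mul_of_nonneg_right ?_ (sq_nonneg _)
        nlinarith [mul_pos hκ hτt]
      have h11 : (Δ t * ‖q t‖) ^ 2 ≤ Δ t * ‖q t‖ ^ 2 := by
        rw [mul_pow]
        refine mul_le_mul_of_nonneg_right ?_ (sq_nonneg _)
        nlinarith [hΔ0 t, hΔ1 t]
      calc (1 + κ * τ t) * |D t| * ‖q (t + 1)‖ ^ 2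
          = |D t| * ((1 + κ * τ t) * ‖q (t + 1)‖ ^ 2) := by ring
        _ ≤ |D t| * (Δ t * ‖q t‖ ^ 2) :=
            mul_le_mul_of_nonneg_left (h10.trans (h9.trans h11)) (abs_nonneg _)
        _ = Δ t * |D t| * ‖q t‖ ^ 2 := by ring
    obtain ⟨t, ht, h⟩ := exists_lt_of_growth (fun t => (hτ t).le) hsum hκ
      (div_pos (abs_pos.2 (hD0 _)) (pow_pos (hqpos _ le_rfl) 2)) hgrow 1
    have h1 := hDle t
    rw [lt_div_iff₀ (pow_pos (hqpos t ht) 2)] at h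
    nlinarith [hcon t ht, hqpos t ht]
  obtain ⟨T, hT, hqp⟩ := hcone
  have hstep : ∀ t ≥ T₀, ‖q t‖ ≤ ‖p t‖ →
      (1 + κ * τ t) * ‖p t‖ ≤ ‖p (t + 1)‖ ∧ ‖q (t + 1)‖ ≤ ‖p (t + 1)‖ := by
    intro t ht h
    have hτt := hτ t
    have h1 : ‖(1 + τ t * (ω t).re : ℂ) * p t‖
        - ‖(τ t * (ω t).im * Complex.I : ℂ) * q t‖ ≤ ‖p (t + 1)‖ := by
      rw [hps]; exact norm_sub_norm_le _ _
    have h2 : ‖q (t + 1)‖ ≤ ‖(1 - τ t * (ω t).re : ℂ) * q t‖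
        + ‖(τ t * (ω t).im * Complex.I : ℂ) * p t‖ := by
      rw [hqs]; exact norm_add_le _ _
    rw [norm_mul _ (p t), norm_mul _ (q t), hn2] at h1 h2
    rw [hn1 t ht] at h1
    rw [hn3 t ht] at h2
    have h3 := mul_le_mul_of_nonneg_left h (mul_nonneg hτt.le (abs_nonneg (ω t).im))
    have h4 := mul_le_mul_of_nonneg_right (mul_le_mul_of_nonneg_left (hT₀ t ht).le hτt.le)
      (norm_nonneg (p t))
    have h5 : 0 ≤ 1 - τ t * (ω t).re := by rw [← hn3 t ht]; exact norm_nonneg _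
    have h6 := mul_le_mul_of_nonneg_left h h5
    have h7 : 0 ≤ τ t * κ * ‖p t‖ := by positivity
    constructor <;> linarith
  have hall : ∀ t ≥ T, ‖q t‖ ≤ ‖p t‖ := fun t ht => by
    induction t, ht using Nat.le_induction with
    | base => exact hqp
    | succ t ht ih => exact (hstep t (hT.le.trans ht) ih).2
  refine ⟨T, ?_, fun t ht => (hstep t (hT.le.trans ht) (hall t ht)).1⟩
  refine lt_of_le_of_ne (norm_nonneg _) fun h => hD0 T ?_
  have h1 := hDle T
  rw [show ‖p T‖ = 0 from h.symm, zero_mul] at h1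
  exact abs_nonpos_iff.1 h1

/-! ### The bilinear form of the network and its Fourier transform -/

variable {d : ℕ} [NeZero d]

/-- The symmetric operator on the parameters whose quadratic form is twice the output of the network
on the input `z`: it maps `(w₁, w₂)` to the correlation of `w₂` with `z` and the convolution of
`w₁` with `z`. -/
noncomputable def couplingOp (z : Vec d) : Params d →L[ℝ] Params d :=
  LinearMap.toContinuousLinearMap
    { toFun := fun W => WithLp.toLp 2 fun lk => if lk.1 = 0
        then (1 / √(d : ℝ)) * ∑ i, W (1, i) * z (i - lk.2)
        else (1 / √(d : ℝ)) * ∑ j, W (0, lk.2 - j) * z j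
      map_add' := fun V W => by
        ext ⟨l, k⟩
        by_cases h : l = 0 <;> simp [h, add_mul, Finset.sum_add_distrib, mul_add]
      map_smul' := fun c W => by
        ext ⟨l, k⟩
        by_cases h : l = 0 <;> simp [h, mul_assoc, Finset.mul_sum, mul_left_comm] }

theorem couplingOp_apply_zero (z : Vec d) (W : Params d) (k : ZMod d) :
    couplingOp z W (0, k) = (1 / √(d : ℝ)) * ∑ i, W (1, i) * z (i - k) := rfl

theorem couplingOp_apply_one (z : Vec d) (W : Params d) (k : ZMod d) :
    couplingOp z W (1, k) = (1 / √(d : ℝ)) * ∑ j, W (0, k - j) * z j := rfl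

theorem couplingOp_smul_left (c : ℝ) (z : Vec d) (W : Params d) :
    couplingOp (c • z) W = c • couplingOp z W := by
  ext ⟨l, k⟩
  fin_cases l
  · change couplingOp (c • z) W (0, k) = c * couplingOp z W (0, k)
    simp only [couplingOp_apply_zero, PiLp.smul_apply, smul_eq_mul, Finset.mul_sum]
    exact Finset.sum_congr rfl fun _ _ => by ring
  · change couplingOp (c • z) W (1, k) = c * couplingOp z W (1, k)
    simp only [couplingOp_apply_one, PiLp.smul_apply, smul_eq_mul, Finset.mul_sum]
    exact Finset.sum_congr rfl fun _ _ => by ring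

theorem couplingOp_add_left (z z' : Vec d) (W : Params d) :
    couplingOp (z + z') W = couplingOp z W + couplingOp z' W := by
  ext ⟨l, k⟩
  fin_cases l
  · change couplingOp (z + z') W (0, k) = couplingOp z W (0, k) + couplingOp z' W (0, k)
    simp only [couplingOp_apply_zero, PiLp.add_apply, mul_add, Finset.sum_add_distrib]
  · change couplingOp (z + z') W (1, k) = couplingOp z W (1, k) + couplingOp z' W (1, k)
    simp only [couplingOp_apply_one, PiLp.add_apply, mul_add, Finset.sum_add_distrib]

theorem couplingOp_sum_smul {n : ℕ} (c : Fin n → ℝ) (x : Fin n → Vec d) (W : Params d) :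
    couplingOp (∑ i, c i • x i) W = ∑ i, c i • couplingOp (x i) W := by
  let f : Vec d →ₗ[ℝ] Params d :=
    { toFun := fun z => couplingOp z W
      map_add' := fun z z' => couplingOp_add_left z z' W
      map_smul' := fun c z => couplingOp_smul_left c z W }
  change f _ = ∑ i, c i • f (x i)
  simp

theorem continuous_couplingOp :
    Continuous fun zW : Vec d × Params d => couplingOp zW.1 zW.2 := by
  refine (PiLp.continuous_toLp 2 _).comp (continuous_pi fun ⟨l, k⟩ => ?_)
  fin_cases l
  · change Continuous fun zW : Vec d × Params d =>
      (1 / √(d : ℝ)) * ∑ i, zW.2 (1, i) * zW.1 (i - k)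
    fun_prop
  · change Continuous fun zW : Vec d × Params d =>
      (1 / √(d : ℝ)) * ∑ j, zW.2 (0, k - j) * zW.1 j
    fun_prop

theorem inner_params (V W : Params d) :
    inner ℝ V W = ∑ k, V (0, k) * W (0, k) + ∑ k, V (1, k) * W (1, k) := by
  simp only [PiLp.inner_apply, RCLike.inner_apply, conj_trivial, Fintype.sum_prod_type,
    Fin.sum_univ_two]
  simp only [mul_comm]

theorem norm_sq_params (W : Params d) :
    ‖W‖ ^ 2 = ‖layer W 0‖ ^ 2 + ‖layer W 1‖ ^ 2 := by
  rw [← real_inner_self_eq_norm_sq, inner_params, EuclideanSpace.real_norm_sq_eq,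
    EuclideanSpace.real_norm_sq_eq]
  simp only [layer, sq]

theorem layer_couplingOp_one (z : Vec d) (W : Params d) :
    layer (couplingOp z W) 1 = circConv (layer W 0) z := by
  ext k
  change couplingOp z W (1, k) = (1 / √(d : ℝ)) * ∑ j, W (0, -j) * z (k + j)
  rw [couplingOp_apply_one]
  congr 1
  exact Fintype.sum_equiv (Equiv.subRight k) _ _ fun j => by simp

theorem inner_couplingOp_comm (z : Vec d) (V W : Params d) :
    inner ℝ V (couplingOp z W) = inner ℝ W (couplingOp z V) := by
  simp only [inner_params, couplingOp_apply_zero, couplingOp_apply_one]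
  have key (V W : Params d) : ∑ k, V (0, k) * ((1 / √(d : ℝ)) * ∑ i, W (1, i) * z (i - k))
      = ∑ k, W (1, k) * ((1 / √(d : ℝ)) * ∑ j, V (0, k - j) * z j) := by
    simp only [Finset.mul_sum]
    rw [Finset.sum_comm]
    refine Finset.sum_congr rfl fun i _ => ?_
    refine Fintype.sum_equiv (Equiv.subLeft i) _ _ fun k => ?_
    simp
    ring
  rw [key V W, key W V, add_comm]

theorem inner_self_couplingOp (z : Vec d) (W : Params d) :
    inner ℝ W (couplingOp z W) = 2 * convNet W z := by
  have h : convNet W z = ∑ k, W (1, k) * couplingOp z W (1, k) := by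
    rw [convNet, ← layer_couplingOp_one]
    simp [PiLp.inner_apply, layer, mul_comm]
  have key : ∑ k, W (0, k) * ((1 / √(d : ℝ)) * ∑ i, W (1, i) * z (i - k))
      = ∑ k, W (1, k) * ((1 / √(d : ℝ)) * ∑ j, W (0, k - j) * z j) := by
    simp only [Finset.mul_sum]
    rw [Finset.sum_comm]
    refine Finset.sum_congr rfl fun i _ => ?_
    refine Fintype.sum_equiv (Equiv.subLeft i) _ _ fun k => ?_
    simp
    ring
  rw [inner_params, h, two_mul]
  congr 1

theorem convNet_add_smul (V W : Params d) (h : ℝ) (z : Vec d) :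
    convNet (W + h • V) z
      = convNet W z + h * inner ℝ V (couplingOp z W) + h ^ 2 * convNet V z := by
  have h1 := inner_self_couplingOp z (W + h • V)
  simp only [map_add, map_smul, inner_add_left, inner_add_right, real_inner_smul_left,
    real_inner_smul_right, inner_self_couplingOp, inner_couplingOp_comm z W V] at h1
  linarith

theorem convNet_smul (c : ℝ) (W : Params d) (z : Vec d) :
    convNet (c • W) z = c ^ 2 * convNet W z := by
  have h1 := inner_self_couplingOp z (c • W)
  simp only [map_smul, real_inner_smul_left, real_inner_smul_right, inner_self_couplingOp] at h1
  linarith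

theorem convNet_input_smul (c : ℝ) (W : Params d) (z : Vec d) :
    convNet W (c • z) = c * convNet W z := by
  rw [convNet_eq_inner_predictor, convNet_eq_inner_predictor, real_inner_smul_right]

theorem convNet_input_add (W : Params d) (z z' : Vec d) :
    convNet W (z + z') = convNet W z + convNet W z' := by
  simp_rw [convNet_eq_inner_predictor, inner_add_right]

theorem fourier_apply (v : Vec d) (k : ZMod d) :
    fourier v k = (1 / √(d : ℝ) : ℝ) * ∑ j, ZMod.stdAddChar (-(j * k)) * (v j : ℂ) := by
  simp [fourier, ZMod.dft_apply]

theorem fourier_smul (c : ℝ) (v : Vec d) : fourier (c • v) = (c : ℂ) • fourier v := by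
  ext k
  simp only [fourier_apply, PiLp.smul_apply, Pi.smul_apply, smul_eq_mul, Finset.mul_sum]
  exact Finset.sum_congr rfl fun _ _ => by push_cast; ring

theorem fourier_add (v w : Vec d) : fourier (v + w) = fourier v + fourier w := by
  ext k
  simp only [fourier_apply, PiLp.add_apply, Pi.add_apply, ← mul_add, ← Finset.sum_add_distrib]
  congr 1
  exact Finset.sum_congr rfl fun _ _ => by push_cast; ring

theorem continuous_fourier : Continuous (fourier (d := d)) := by
  refine continuous_pi fun k => ?_
  simp only [fourier_apply]
  fun_prop

open ComplexConjugate in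
theorem conj_stdAddChar (j : ZMod d) :
    conj (ZMod.stdAddChar j) = ZMod.stdAddChar (-j) := by
  rw [AddChar.map_neg_eq_conj]

theorem fourier_layer_couplingOp_one (z : Vec d) (W : Params d) (k : ZMod d) :
    fourier (layer (couplingOp z W) 1) k = fourier z k * fourier (layer W 0) k := by
  simp only [fourier_apply]
  have h (i : ZMod d) : ((layer (couplingOp z W) 1 i : ℝ) : ℂ)
      = (1 / √(d : ℝ) : ℝ) * ∑ j, (layer W 0 (i - j) : ℂ) * z j := by
    change ((couplingOp z W (1, i) : ℝ) : ℂ) = _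
    rw [couplingOp_apply_one]
    push_cast
    rfl
  simp only [h, Finset.mul_sum, Finset.sum_mul]
  rw [Finset.sum_comm]
  conv_rhs => rw [Finset.sum_comm]
  refine Finset.sum_congr rfl fun j _ => ?_
  refine Fintype.sum_equiv (Equiv.subRight j) _ _ fun i => ?_
  have : (ZMod.stdAddChar (-(i * k)) : ℂ)
      = ZMod.stdAddChar (-(j * k)) * ZMod.stdAddChar (-((i - j) * k)) := by
    rw [← AddChar.map_add_eq_mul]; congr 1; ring
  rw [this]
  simp only [Equiv.subRight_apply]
  ring

open ComplexConjugate in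
theorem fourier_layer_couplingOp_zero (z : Vec d) (W : Params d) (k : ZMod d) :
    fourier (layer (couplingOp z W) 0) k = conj (fourier z k) * fourier (layer W 1) k := by
  simp only [fourier_apply, map_mul, map_sum, Complex.conj_ofReal, conj_stdAddChar, neg_neg]
  have h (i : ZMod d) : ((layer (couplingOp z W) 0 i : ℝ) : ℂ)
      = (1 / √(d : ℝ) : ℝ) * ∑ j, (layer W 1 j : ℂ) * z (j - i) := by
    change ((couplingOp z W (0, i) : ℝ) : ℂ) = _
    rw [couplingOp_apply_zero]
    push_cast
    rfl
  simp only [h, Finset.mul_sum, Finset.sum_mul]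
  rw [Finset.sum_comm]
  refine Finset.sum_congr rfl fun j _ => ?_
  refine Fintype.sum_equiv (Equiv.subLeft j) _ _ fun i => ?_
  have : (ZMod.stdAddChar (-(i * k)) : ℂ)
      = ZMod.stdAddChar ((j - i) * k) * ZMod.stdAddChar (-(j * k)) := by
    rw [← AddChar.map_add_eq_mul]; congr 1; ring
  rw [this]
  simp only [Equiv.subLeft_apply]
  ring

theorem sum_norm_sq_fourier (v : Vec d) : ∑ k, ‖fourier v k‖ ^ 2 = ‖v‖ ^ 2 := by
  have hd : (0 : ℝ) < d := Nat.cast_pos.2 (NeZero.pos d)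
  suffices h : ((∑ k, ‖fourier v k‖ ^ 2 : ℝ) : ℂ) = ((‖v‖ ^ 2 : ℝ) : ℂ) by exact_mod_cast h
  have h1 (k : ZMod d) : ((‖fourier v k‖ ^ 2 : ℝ) : ℂ)
      = (1 / d : ℝ) * ∑ i, ∑ j, (v i * v j : ℂ) * ZMod.stdAddChar (k * (j - i)) := by
    have hsq : ((1 / √(d : ℝ) : ℝ) : ℂ) * ((1 / √(d : ℝ) : ℝ) : ℂ) = ((1 / d : ℝ) : ℂ) := by
      rw [← Complex.ofReal_mul, div_mul_div_comm, Real.mul_self_sqrt hd.le, one_mul]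
    rw [Complex.ofReal_pow, ← Complex.mul_conj', fourier_apply, map_mul, Complex.conj_ofReal,
      mul_mul_mul_comm, hsq, map_sum, Finset.sum_mul_sum]
    congr 1
    refine Finset.sum_congr rfl fun i _ => Finset.sum_congr rfl fun j _ => ?_
    rw [map_mul, Complex.conj_ofReal, conj_stdAddChar, neg_neg,
      show k * (j - i) = -(i * k) + j * k by ring, AddChar.map_add_eq_mul]
    ring
  rw [Complex.ofReal_sum]
  simp only [h1]
  rw [← Finset.mul_sum, Finset.sum_comm]
  have h2 (i : ZMod d) : ∑ k : ZMod d, ∑ j, (v i * v j : ℂ) * ZMod.stdAddChar (k * (j - i))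
      = d * (v i * v i) := by
    rw [Finset.sum_comm, Finset.sum_eq_single i]
    · simp [ZMod.card]
    · intro j _ hj
      rw [← Finset.mul_sum, AddChar.sum_mulShift _ (ZMod.isPrimitive_stdAddChar d),
        if_neg (sub_ne_zero.2 hj)]
      simp
    · simp
  simp only [h2]
  rw [← Finset.mul_sum, EuclideanSpace.real_norm_sq_eq]
  have : (d : ℂ) ≠ 0 := by exact_mod_cast hd.ne'
  push_cast
  field_simp

/-- Convolution with `δ` multiplies the `ℓ₂` norm by at most the `ℓ_∞` norm of the Fourier transform
of `δ`. -/
theorem norm_circConv_le (w δ : Vec d) : ‖circConv w δ‖ ≤ ‖fourier δ‖ * ‖w‖ := by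
  let W : Params d := WithLp.toLp 2 fun lk => w lk.2
  have h : circConv w δ = layer (couplingOp δ W) 1 := (layer_couplingOp_one δ W).symm
  refine le_of_sq_le_sq ?_ (by positivity)
  rw [mul_pow, ← sum_norm_sq_fourier, ← sum_norm_sq_fourier, Finset.mul_sum]
  refine Finset.sum_le_sum fun k _ => ?_
  rw [h, fourier_layer_couplingOp_one, norm_mul, mul_pow]
  exact mul_le_mul_of_nonneg_right
    (pow_le_pow_left₀ (norm_nonneg _) (norm_le_pi_norm (fourier δ) k) 2) (sq_nonneg _)

theorem abs_convNet_le (W : Params d) (δ : Vec d) :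
    |convNet W δ| ≤ ‖fourier δ‖ * (‖W‖ ^ 2 / 2) := by
  have h1 : |convNet W δ| ≤ ‖layer W 1‖ * (‖fourier δ‖ * ‖layer W 0‖) :=
    (abs_real_inner_le_norm _ _).trans
      (mul_le_mul_of_nonneg_left (norm_circConv_le _ _) (norm_nonneg _))
  rw [norm_sq_params]
  nlinarith [mul_nonneg (norm_nonneg (fourier δ)) (sq_nonneg (‖layer W 1‖ - ‖layer W 0‖))]

/-- A bound on the quadratic form `W ↦ -2 * convNet W z` bounds the Fourier coefficients of `z`: the
real and imaginary part of a character are eigenvectors up to a phase. -/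
theorem norm_fourier_le_of_forall_convNet (z : Vec d) {K : ℝ} (hK0 : 0 ≤ K)
    (hK : ∀ W : Params d, -(2 * convNet W z) ≤ K * ‖W‖ ^ 2) (k : ZMod d) :
    ‖fourier z k‖ ≤ K := by
  -- testing the bound on `(w, -t • (w ⋆ z))`
  have hconv : ∀ w : Vec d, ‖circConv w z‖ ^ 2 ≤ K ^ 2 * ‖w‖ ^ 2 := by
    intro w
    have ht : ∀ t : ℝ, 2 * t * ‖circConv w z‖ ^ 2
        ≤ K * (‖w‖ ^ 2 + t ^ 2 * ‖circConv w z‖ ^ 2) := by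
      intro t
      let W : Params d := WithLp.toLp 2 fun lk =>
        if lk.1 = 0 then w lk.2 else -t * circConv w z lk.2
      have e0 : layer W 0 = w := rfl
      have e1 : layer W 1 = (-t) • circConv w z := rfl
      have := hK W
      rw [norm_sq_params, convNet, e0, e1, norm_smul, mul_pow, real_inner_smul_left,
        real_inner_self_eq_norm_sq] at this
      simp only [norm_neg, Real.norm_eq_abs, sq_abs] at this
      linarith
    rcases hK0.eq_or_lt with rfl | hpos
    · have := ht 1
      nlinarith [sq_nonneg ‖circConv w z‖]
    · have := ht K⁻¹
      have e : K * (‖w‖ ^ 2 + K⁻¹ ^ 2 * ‖circConv w z‖ ^ 2)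
          = K * ‖w‖ ^ 2 + K⁻¹ * ‖circConv w z‖ ^ 2 := by field_simp
      rw [e] at this
      have h2 : K⁻¹ * ‖circConv w z‖ ^ 2 ≤ K * ‖w‖ ^ 2 := by linarith
      rw [inv_mul_le_iff₀ hpos] at h2
      linarith
  have hd : (0 : ℝ) < d := Nat.cast_pos.2 (NeZero.pos d)
  let χ : ZMod d → ℂ := fun j => ZMod.stdAddChar (j * k)
  have hχ (j : ZMod d) : ‖χ j‖ = 1 := AddChar.norm_apply _ _
  let u : Vec d := WithLp.toLp 2 fun j => (χ j).re
  let v : Vec d := WithLp.toLp 2 fun j => (χ j).im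
  have huv : ‖u‖ ^ 2 + ‖v‖ ^ 2 = d := by
    rw [EuclideanSpace.real_norm_sq_eq, EuclideanSpace.real_norm_sq_eq, ← Finset.sum_add_distrib]
    have : ∀ j, u j ^ 2 + v j ^ 2 = 1 := fun j => by
      have := hχ j
      rw [← sq_eq_sq₀ (norm_nonneg _) zero_le_one, ← Complex.normSq_eq_norm_sq,
        Complex.normSq_apply] at this
      change (χ j).re ^ 2 + (χ j).im ^ 2 = 1
      linarith
    simp [this, ZMod.card]
  have hcv (i : ZMod d) : (circConv u z i : ℂ) + circConv v z i * Complex.I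
      = χ i * fourier z k := by
    have h1 : ∀ j, χ (-j) = u (-j) + v (-j) * Complex.I := fun j =>
      (Complex.re_add_im _).symm
    have h2 : (circConv u z i : ℂ) + circConv v z i * Complex.I
        = (1 / √(d : ℝ) : ℝ) * ∑ j, χ (-j) * z (i + j) := by
      simp only [h1, circConv, Finset.mul_sum, Complex.ofReal_sum, Complex.ofReal_mul,
        Finset.sum_mul, ← Finset.sum_add_distrib]
      exact Finset.sum_congr rfl fun _ _ => by ring
    rw [h2, fourier_apply, mul_left_comm]
    congr 1
    rw [Finset.mul_sum]
    refine Fintype.sum_equiv (Equiv.addLeft i) _ _ fun j => ?_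
    rw [Equiv.coe_addLeft, ← mul_assoc]
    congr 1
    change ZMod.stdAddChar _ = ZMod.stdAddChar _ * ZMod.stdAddChar _
    rw [← AddChar.map_add_eq_mul]
    congr 1
    ring
  have hsum : ‖circConv u z‖ ^ 2 + ‖circConv v z‖ ^ 2 = d * ‖fourier z k‖ ^ 2 := by
    rw [EuclideanSpace.real_norm_sq_eq, EuclideanSpace.real_norm_sq_eq, ← Finset.sum_add_distrib]
    have (i : ZMod d) : circConv u z i ^ 2 + circConv v z i ^ 2 = ‖fourier z k‖ ^ 2 := by
      have := congrArg norm (hcv i)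
      rw [norm_mul, hχ, one_mul] at this
      rw [← this, Complex.norm_add_mul_I, Real.sq_sqrt (by positivity)]
    simp [this, ZMod.card]
  have h3 := add_le_add (hconv u) (hconv v)
  rw [hsum, ← mul_add, huv, mul_comm] at h3
  exact le_of_sq_le_sq (le_of_mul_le_mul_right h3 hd) hK0

/-! ### Gradients of the risk and admissible step sizes -/

theorem hasGradientAt_convNet (z : Vec d) (W : Params d) :
    HasGradientAt (fun W => convNet W z) (couplingOp z W) W := by
  have h : (fun W : Params d => convNet W z) = fun W => 2⁻¹ * inner ℝ W (couplingOp z W) := by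
    ext W
    rw [inner_self_couplingOp]; ring
  rw [h, hasGradientAt_iff_hasFDerivAt]
  refine (((hasFDerivAt_id W).inner ℝ (couplingOp z).hasFDerivAt).const_mul 2⁻¹).congr_fderiv ?_
  ext V
  simp [real_inner_comm V, inner_couplingOp_comm z W V]
  ring

theorem continuous_convNet (z : Vec d) : Continuous fun W : Params d => convNet W z :=
  continuous_iff_continuousAt.2 fun W => (hasGradientAt_convNet z W).continuousAt

theorem hasGradientAt_expRisk {E : Type*} [NormedAddCommGroup E] [InnerProductSpace ℝ E]
    [CompleteSpace E] {n : ℕ} (y : Fin n → ℝ) {f : Fin n → E → ℝ} {g : Fin n → E} {u : E}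
    (hf : ∀ i, HasGradientAt (f i) (g i) u) :
    HasGradientAt (fun u => (1 / (n : ℝ)) * ∑ i, Real.exp (-(y i * f i u)))
      (-∑ i, (1 / (n : ℝ) * Real.exp (-(y i * f i u)) * y i) • g i) u := by
  rw [hasGradientAt_iff_hasFDerivAt]
  refine ((HasFDerivAt.fun_sum fun i _ =>
    (((hf i).hasFDerivAt.const_mul (y i)).neg).exp).const_mul (1 / (n : ℝ))).congr_fderiv ?_
  ext v
  simp [Finset.mul_sum, mul_assoc]

/-- The factor with which the data point `i` enters the negative gradient of the risk. -/
noncomputable def lossWeight {n : ℕ} (x : Fin n → Vec d) (y : Fin n → ℝ) (W : Params d)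
    (i : Fin n) : ℝ :=
  1 / (n : ℝ) * Real.exp (-(y i * convNet W (x i)))

/-- The negative gradient of the risk with respect to the linear predictor, as a function of the
parameters. -/
noncomputable def residual {n : ℕ} (x : Fin n → Vec d) (y : Fin n → ℝ) (W : Params d) : Vec d :=
  ∑ i, (lossWeight x y W i * y i) • x i

theorem gradient_linRisk {n : ℕ} (x : Fin n → Vec d) (y : Fin n → ℝ) (W : Params d) :
    gradient (linRisk x y) (predictor W) = -residual x y W := by
  have h (i : Fin n) : HasGradientAt (fun β : Vec d => inner ℝ β (x i)) (x i) (predictor W) := by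
    rw [hasGradientAt_iff_hasFDerivAt]
    refine ((hasFDerivAt_id _).inner ℝ (hasFDerivAt_const (x i) _)).congr_fderiv ?_
    ext v
    simp [real_inner_comm]
  have := (hasGradientAt_expRisk y h).gradient
  simp only [← convNet_eq_inner_predictor] at this
  exact this

theorem gradient_netRisk {n : ℕ} (x : Fin n → Vec d) (y : Fin n → ℝ) (W : Params d) :
    gradient (netRisk x y) W = -couplingOp (residual x y W) W := by
  rw [residual, couplingOp_sum_smul]
  exact (hasGradientAt_expRisk y fun i => hasGradientAt_convNet (x i) W).gradient

/-- The Hessian of the risk is the sum of a positive semidefinite form and of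
`V ↦ -2 * convNet V z`, where `z` is the residual, so a Lipschitz constant of the gradient bounds
the latter. -/
theorem neg_convNet_residual_le {n : ℕ} {x : Fin n → Vec d} {y : Fin n → ℝ} {W : Params d} {K : ℝ≥0}
    {U : Set (Params d)} (hU : U ∈ 𝓝 W) (hK : LipschitzOnWith K (gradient (netRisk x y)) U)
    (V : Params d) : -(2 * convNet V (residual x y W)) ≤ K * ‖V‖ ^ 2 := by
  let b : Fin n → ℝ := fun i => inner ℝ V (couplingOp (x i) W)
  let c : Fin n → ℝ := fun i => convNet W (x i)
  let e : Fin n → ℝ := fun i => convNet V (x i)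
  let f : ℝ → ℝ := fun s => ∑ i, (1 / (n : ℝ)) *
    (Real.exp (-(y i * (c i + s * b i + s ^ 2 * e i))) * (-(y i * (b i + s * (2 * e i)))))
  have hf (s : ℝ) : f s = inner ℝ (gradient (netRisk x y) (W + s • V)) V := by
    rw [gradient_netRisk, residual, couplingOp_sum_smul, inner_neg_left, sum_inner,
      ← Finset.sum_neg_distrib]
    refine Finset.sum_congr rfl fun i _ => ?_
    rw [real_inner_smul_left, real_inner_comm, map_add, map_smul, inner_add_right,
      real_inner_smul_right, inner_self_couplingOp, lossWeight, convNet_add_smul]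
    ring
  have hder : HasDerivAt f (∑ i, (1 / (n : ℝ)) * (Real.exp (-(y i * c i)) * (y i * b i) ^ 2
      + Real.exp (-(y i * c i)) * (-(y i * (2 * e i))))) 0 := by
    refine HasDerivAt.fun_sum fun i _ => HasDerivAt.const_mul _ ?_
    have h1 : HasDerivAt (fun s : ℝ => -(y i * (c i + s * b i + s ^ 2 * e i))) (-(y i * b i)) 0 := by
      refine (((((hasDerivAt_id' (0 : ℝ)).mul_const (b i)).const_add (c i)).add
        ((hasDerivAt_pow 2 (0 : ℝ)).mul_const (e i))).const_mul (y i)).neg.congr_deriv ?_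
      simp
    have h2 : HasDerivAt (fun s : ℝ => -(y i * (b i + s * (2 * e i)))) (-(y i * (2 * e i))) 0 := by
      refine (((hasDerivAt_id' (0 : ℝ)).mul_const (2 * e i)).const_add (b i)).const_mul (y i)
        |>.neg.congr_deriv ?_
      simp
    refine (h1.exp.mul h2).congr_deriv ?_
    simp only [zero_mul, add_zero, ne_eq, OfNat.ofNat_ne_zero, not_false_eq_true, zero_pow]
    ring
  have hlow : -(2 * convNet V (residual x y W)) ≤
      ∑ i, (1 / (n : ℝ)) * (Real.exp (-(y i * c i)) * (y i * b i) ^ 2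
      + Real.exp (-(y i * c i)) * (-(y i * (2 * e i)))) := by
    rw [convNet_eq_inner_predictor, residual, inner_sum, Finset.mul_sum, ← Finset.sum_neg_distrib]
    refine Finset.sum_le_sum fun i _ => ?_
    rw [real_inner_smul_right, ← convNet_eq_inner_predictor, lossWeight]
    have : 0 ≤ 1 / (n : ℝ) * (Real.exp (-(y i * c i)) * (y i * b i) ^ 2) := by positivity
    simp only [c, e] at this ⊢
    linarith
  refine hlow.trans ?_
  have hslope := (hasDerivAt_iff_tendsto_slope.1 hder).mono_left (nhdsGT_le_nhdsNE 0)
  refine le_of_tendsto hslope ?_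
  have hcont : Tendsto (fun s : ℝ => W + s • V) (𝓝[>] 0) (𝓝 W) := by
    have : ContinuousAt (fun s : ℝ => W + s • V) 0 := by fun_prop
    have h := this.tendsto.mono_left (nhdsWithin_le_nhds (s := Set.Ioi 0))
    simpa using h
  filter_upwards [hcont.eventually_mem hU, self_mem_nhdsWithin] with s hs hs0
  have hs0 : 0 < s := hs0
  rw [slope_def_field, sub_zero, div_le_iff₀ hs0]
  have h0 := hf 0
  rw [zero_smul, add_zero] at h0
  rw [hf, h0, ← inner_sub_left]
  have h1 := hK.dist_le_mul _ hs _ (mem_of_mem_nhds hU)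
  rw [dist_eq_norm, dist_eq_norm, add_sub_cancel_left, norm_smul, Real.norm_of_nonneg hs0.le] at h1
  refine (real_inner_le_norm _ _).trans ((mul_le_mul_of_nonneg_right h1 (norm_nonneg _)).trans ?_)
  linarith

theorem IsAdmissibleStep.mul_norm_fourier_lt_one {n : ℕ} {x : Fin n → Vec d} {y : Fin n → ℝ}
    {W : Params d} {s : ℝ} (h : IsAdmissibleStep (netRisk x y) s W) (k : ZMod d) :
    s * ‖fourier (residual x y W) k‖ < 1 := by
  obtain ⟨hs, K, ⟨U, hU, hK⟩, hlt⟩ := h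
  refine lt_of_le_of_lt (mul_le_mul_of_nonneg_left ?_ hs.le) hlt
  exact norm_fourier_le_of_forall_convNet _ K.2 (neg_convNet_residual_le hU hK) k

/-! ### Almost all initializations are unbalanced -/

theorem continuous_fourier_layer (l : Fin 2) (k : ZMod d) :
    Continuous fun W : Params d => fourier (layer W l) k := by
  have h : Continuous fun W : Params d => layer W l :=
    (PiLp.continuous_toLp 2 _).comp (continuous_pi fun k => by fun_prop)
  exact (continuous_apply k).comp (continuous_fourier.comp h)

/-- The two layers of a generic network have different amplitudes at every frequency. -/
theorem ae_norm_fourier_layer_ne :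
    ∀ᵐ W : Params d, ∀ k, ‖fourier (layer W 1) k‖ ≠ ‖fourier (layer W 0) k‖ := by
  rw [ae_all_iff]
  intro k
  have hd : (0 : ℝ) < √(d : ℝ) := Real.sqrt_pos.2 (Nat.cast_pos.2 (NeZero.pos d))
  -- every line in the direction of this network contains at most two exceptional points
  let V : Params d := EuclideanSpace.single ((1 : Fin 2), (0 : ZMod d)) 1
  have hopen : IsOpen {W : Params d | ‖fourier (layer W 1) k‖ ≠ ‖fourier (layer W 0) k‖} :=
    isOpen_ne_fun (continuous_fourier_layer 1 k).norm (continuous_fourier_layer 0 k).norm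
  refine ae_mem_of_ae_add_linearMap_mem (LinearMap.toSpanSingleton ℝ (Params d) V) volume volume
    hopen.measurableSet fun W => ?_
  have h0 (t : ℝ) : layer (W + t • V) 0 = layer W 0 := by
    ext j
    simp [layer, V]
  have h1 (t : ℝ) : fourier (layer (W + t • V) 1) k
      = fourier (layer W 1) k + ((t / √(d : ℝ) : ℝ) : ℂ) := by
    have e : layer (W + t • V) 1 = layer W 1 + t • EuclideanSpace.single (0 : ZMod d) (1 : ℝ) := by
      ext j
      simp [layer, V]
    rw [e, fourier_add, fourier_smul, Pi.add_apply, Pi.smul_apply,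
      fourier_apply (EuclideanSpace.single _ _),
      Finset.sum_eq_single 0]
    · simp
      rfl
    · intro j _ hj
      simp [hj]
    · simp
  set β := fourier (layer W 1) k
  set r := ‖fourier (layer W 0) k‖
  have hfin : {t : ℝ | ¬ ‖β + ((t / √(d : ℝ) : ℝ) : ℂ)‖ ≠ r}.Finite := by
    refine (Set.toFinite {(√(r ^ 2 - β.im ^ 2) - β.re) * √(d : ℝ),
      (-√(r ^ 2 - β.im ^ 2) - β.re) * √(d : ℝ)}).subset fun t ht => ?_
    have ht : ‖β + ((t / √(d : ℝ) : ℝ) : ℂ)‖ = r := not_not.1 ht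
    have h2 : (β.re + t / √(d : ℝ)) ^ 2 = r ^ 2 - β.im ^ 2 := by
      rw [← ht, ← Complex.normSq_eq_norm_sq, Complex.normSq_apply]
      simp
      ring
    have h3 : √(r ^ 2 - β.im ^ 2) = |β.re + t / √(d : ℝ)| := by rw [← h2, Real.sqrt_sq_eq_abs]
    have h4 : t = (t / √(d : ℝ)) * √(d : ℝ) := (div_mul_cancel₀ t hd.ne').symm
    rw [h3]
    rcases abs_choice (β.re + t / √(d : ℝ)) with h | h
    · left
      rw [h]; linarith
    · right
      rw [Set.mem_singleton_iff, h]; linarith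
  filter_upwards [compl_mem_ae_iff.2 (hfin.measure_zero volume)] with t ht
  change ‖fourier (layer (W + t • V) 1) k‖ ≠ ‖fourier (layer (W + t • V) 0) k‖
  rw [h0, h1]
  exact not_not.1 ht

/-! ### The limit direction is a leading eigenvector -/

/-- If the normalized increments `g` of a divergent sequence converge, the sequence converges in the
direction of their limit (a Stolz–Cesàro argument). -/
theorem eq_norm_smul_of_tendstoInDirection {E : Type*} [NormedAddCommGroup E] [NormedSpace ℝ E]
    {W g : ℕ → E} {σ : ℕ → ℝ} {u w : E} (hσ : ∀ t, 0 ≤ σ t)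
    (hW : ∀ t, W (t + 1) = W t + σ t • g t) (hg : Tendsto g atTop (𝓝 w))
    (htop : Tendsto (fun t => ‖W t‖) atTop atTop) (hu : TendstoInDirection W u) :
    w = ‖w‖ • u := by
  obtain ⟨C, hC⟩ := hg.norm.bddAbove_range
  have hC' : ∀ t, ‖g t‖ ≤ |C| + 1 := fun t => by
    linarith [hC ⟨t, rfl⟩, le_abs_self C]
  have hC0 : 0 < |C| + 1 := by positivity
  set S : ℕ → ℝ := fun n => ∑ t ∈ Finset.range n, σ t with hS
  have hbound : ∀ n, ‖W n‖ ≤ ‖W 0‖ + (|C| + 1) * S n := by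
    intro n
    induction n with
    | zero => simp [hS]
    | succ n ih =>
      have h1 : ‖σ n • g n‖ ≤ σ n * (|C| + 1) := by
        rw [norm_smul, Real.norm_of_nonneg (hσ n)]
        exact mul_le_mul_of_nonneg_left (hC' n) (hσ n)
      have h2 : S (n + 1) = S n + σ n := Finset.sum_range_succ _ _
      rw [hW, h2]
      linarith [norm_add_le (W n) (σ n • g n)]
  have hStop : Tendsto S atTop atTop := by
    have h1 := tendsto_atTop_mono hbound htop
    have h2 := tendsto_atTop_add_const_left atTop (-‖W 0‖) h1
    simp only [neg_add_cancel_left] at h2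
    exact (tendsto_const_mul_atTop_of_pos hC0).1 h2
  have hlit : (fun t => σ t • (g t - w)) =o[atTop] σ := by
    have h1 : (fun t => g t - w) =o[atTop] fun _ => (1 : ℝ) :=
      (Asymptotics.isLittleO_one_iff ℝ).2 (by simpa using hg.sub_const w)
    simpa using (Asymptotics.isBigO_refl σ atTop).smul_isLittleO h1
  have hsum : ∀ n, ∑ t ∈ Finset.range n, σ t • (g t - w) = W n - W 0 - S n • w := by
    intro n
    induction n with
    | zero => simp [hS]
    | succ n ih =>
      have h2 : S (n + 1) = S n + σ n := Finset.sum_range_succ _ _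
      rw [Finset.sum_range_succ, ih, hW, h2]
      module
  have h1 : Tendsto (fun n => (S n)⁻¹ • (W n - W 0 - S n • w)) atTop (𝓝 0) := by
    have := (hlit.sum_range hσ hStop).tendsto_inv_smul_nhds_zero
    simpa only [hsum] using this
  have h2 : Tendsto (fun n => (S n)⁻¹ • W 0) atTop (𝓝 0) := by
    simpa using hStop.inv_tendsto_atTop.smul_const (W 0)
  have h3 : Tendsto (fun n => (S n)⁻¹ • W n) atTop (𝓝 w) := by
    have h4 := (h1.add h2).add_const w
    rw [add_zero, zero_add] at h4
    refine h4.congr' ?_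
    filter_upwards [hStop.eventually_gt_atTop 0] with n hn
    rw [smul_sub, smul_sub, smul_smul, inv_mul_cancel₀ hn.ne', one_smul]
    abel
  have h5 : Tendsto (fun n => ((S n)⁻¹ * ‖W n‖) • (‖W n‖⁻¹ • W n)) atTop (𝓝 (‖w‖ • u)) := by
    refine Tendsto.smul (h3.norm.congr' ?_) hu
    filter_upwards [hStop.eventually_gt_atTop 0] with n hn
    rw [norm_smul, norm_inv, Real.norm_of_nonneg hn.le]
  refine tendsto_nhds_unique h3 (h5.congr' ?_)
  filter_upwards [htop.eventually_gt_atTop 0] with n hn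
  rw [smul_smul, mul_assoc, mul_inv_cancel₀ hn.ne', mul_one]

theorem norm_fourier_layer_le (W : Params d) (l : Fin 2) (k : ZMod d) :
    ‖fourier (layer W l) k‖ ≤ ‖W‖ := by
  refine le_of_sq_le_sq ?_ (norm_nonneg _)
  have h1 : ‖fourier (layer W l) k‖ ^ 2 ≤ ‖layer W l‖ ^ 2 := by
    rw [← sum_norm_sq_fourier]
    exact Finset.single_le_sum (f := fun k => ‖fourier (layer W l) k‖ ^ 2)
      (fun _ _ => sq_nonneg _) (Finset.mem_univ k)
  rw [norm_sq_params]
  fin_cases l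
  · exact h1.trans (le_add_of_nonneg_right (sq_nonneg _))
  · exact h1.trans (le_add_of_nonneg_left (sq_nonneg _))

open ComplexConjugate in
/-- For gradient descent from an unbalanced initialization, some linear functional of the Fourier
coefficients of the iterates at the frequency `k` eventually grows at every exponential rate below the
limit of the coupling strength. The first layer is rotated so that this limit becomes positive. -/
theorem exists_growth_frequency {W : ℕ → Params d} {r : ℕ → Vec d} {η : ℕ → ℝ} {z : Vec d}
    (hη : ∀ t, 0 < η t) (hW : ∀ t, W (t + 1) = W t + η t • couplingOp (r t) (W t))
    (hlt : ∀ t k, η t * ‖fourier (r t) k‖ < 1) (hr : ∀ t, r t ≠ 0) (hz : TendstoInDirection r z)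
    (hsum : Tendsto (fun n => ∑ t ∈ Finset.range n, η t * ‖r t‖) atTop atTop) {k : ZMod d}
    (h0 : ‖fourier (layer (W 0) 1) k‖ ≠ ‖fourier (layer (W 0) 0) k‖) {κ : ℝ} (hκ : 0 < κ)
    (hκz : κ < ‖fourier z k‖) :
    ∃ (p : ℕ → ℝ) (T : ℕ), (∀ t, p t ≤ 2 * ‖W t‖) ∧ (∀ t ≥ T, 0 < p t) ∧
      ∀ t ≥ T, (1 + κ * (η t * ‖r t‖)) * p t ≤ p (t + 1) := by
  have hτ : ∀ t, 0 < η t * ‖r t‖ := fun t => mul_pos (hη t) (norm_pos_iff.2 (hr t))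
  obtain ⟨e, hen, hez⟩ : ∃ e : ℂ, ‖e‖ = 1 ∧ fourier z k * conj e = ‖fourier z k‖ := by
    have h1 : (‖fourier z k‖ : ℂ) ≠ 0 := by exact_mod_cast (hκ.trans hκz).ne'
    refine ⟨fourier z k / ‖fourier z k‖, ?_, ?_⟩
    · rw [norm_div, Complex.norm_real, norm_norm, div_self (hκ.trans hκz).ne']
    · rw [map_div₀, Complex.conj_ofReal, mul_div_assoc', Complex.mul_conj', sq,
        mul_div_cancel_right₀ _ h1]
  have hee : conj e * e = 1 := by
    rw [mul_comm, Complex.mul_conj', hen]; simp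
  let b : ℕ → ℂ := fun t => fourier (layer (W t) 1) k
  let a : ℕ → ℂ := fun t => e * fourier (layer (W t) 0) k
  let ω : ℕ → ℂ := fun t => fourier (‖r t‖⁻¹ • r t) k * conj e
  have hω : Tendsto ω atTop (𝓝 (‖fourier z k‖ : ℂ)) := by
    rw [← hez]
    exact ((((continuous_apply k).comp continuous_fourier).tendsto z).comp hz).mul_const (conj e)
  have hτω : ∀ t, ((η t * ‖r t‖ : ℝ) : ℂ) * ω t = η t * fourier (r t) k * conj e := fun t => by
    have h5 : (‖r t‖ : ℂ) ≠ 0 := by exact_mod_cast norm_ne_zero_iff.2 (hr t)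
    simp only [ω, fourier_smul, Pi.smul_apply, smul_eq_mul]
    push_cast
    field_simp
  have hlayer : ∀ t i, fourier (layer (W (t + 1)) i) k
      = fourier (layer (W t) i) k + η t * fourier (layer (couplingOp (r t) (W t)) i) k := by
    intro t i
    have h5 : layer (W (t + 1)) i = layer (W t) i + η t • layer (couplingOp (r t) (W t)) i := by
      rw [hW]; rfl
    rw [h5, fourier_add, fourier_smul]
    rfl
  have hb : ∀ t, b (t + 1) = b t + ((η t * ‖r t‖ : ℝ) : ℂ) * (ω t * a t) := fun t => by
    rw [← mul_assoc, hτω]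
    simp only [b, a]
    rw [hlayer, fourier_layer_couplingOp_one]
    linear_combination (-(η t * fourier (r t) k * fourier (layer (W t) 0) k)) * hee
  have ha : ∀ t, a (t + 1) = a t + ((η t * ‖r t‖ : ℝ) : ℂ) * (conj (ω t) * b t) := fun t => by
    have h5 := congrArg conj (hτω t)
    simp only [map_mul, Complex.conj_ofReal, Complex.conj_conj] at h5
    rw [← mul_assoc, h5]
    simp only [b, a]
    rw [hlayer, fourier_layer_couplingOp_zero]
    ring
  have hlt' : ∀ t, η t * ‖r t‖ * ‖ω t‖ < 1 := fun t => by
    have h5 : η t * ‖r t‖ * ‖ω t‖ = η t * ‖fourier (r t) k‖ := by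
      rw [← Complex.norm_of_nonneg (hτ t).le, ← norm_mul, hτω, norm_mul _ (conj e),
        RCLike.norm_conj, hen, mul_one, norm_mul, Complex.norm_of_nonneg (hη t).le]
    rw [h5]
    exact hlt t k
  have h0' : ‖b 0‖ ≠ ‖a 0‖ := by
    simp only [b, a, norm_mul, hen, one_mul]; exact h0
  obtain ⟨T, hT, hgrow⟩ := exists_growth_of_norm_ne hτ hb ha hω hlt' h0' hsum hκ hκz
  refine ⟨fun t => ‖b t + a t‖, T, fun t => ?_, fun t ht => ?_, hgrow⟩
  · have h7 : ‖a t‖ ≤ ‖W t‖ := by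
      simp only [a, norm_mul, hen, one_mul]
      exact norm_fourier_layer_le _ _ _
    have h8 : ‖b t‖ ≤ ‖W t‖ := norm_fourier_layer_le _ _ _
    have := norm_add_le (b t) (a t)
    change ‖b t + a t‖ ≤ 2 * ‖W t‖
    linarith
  · induction t, ht using Nat.le_induction with
    | base => exact hT
    | succ t ht ih =>
      exact lt_of_lt_of_le (mul_pos (by have := mul_pos hκ (hτ t); linarith) ih) (hgrow t ht)

/-- For gradient descent from an unbalanced initialization, the limit direction `u` is an eigenvector
of the coupling operator of the limit direction `z` of the residuals, for an eigenvalue that is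
maximal: the eigenvalues are `±‖fourier z k‖`. A frequency `k` with a larger value would grow at a
larger exponential rate than the iterates do. -/
theorem exists_couplingOp_eq_smul {W : ℕ → Params d} {r : ℕ → Vec d} {η : ℕ → ℝ} {u : Params d}
    {z : Vec d} (hη : ∀ t, 0 < η t) (hW : ∀ t, W (t + 1) = W t + η t • couplingOp (r t) (W t))
    (hlt : ∀ t k, η t * ‖fourier (r t) k‖ < 1) (hr : ∀ t, r t ≠ 0)
    (htop : Tendsto (fun t => ‖W t‖) atTop atTop) (hu : TendstoInDirection W u)
    (hz : TendstoInDirection r z)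
    (h0 : ∀ k, ‖fourier (layer (W 0) 1) k‖ ≠ ‖fourier (layer (W 0) 0) k‖) :
    ∃ l : ℝ, couplingOp z u = l • u ∧ ∀ k, ‖fourier z k‖ ≤ l := by
  have hτ : ∀ t, 0 < η t * ‖r t‖ := fun t => mul_pos (hη t) (norm_pos_iff.2 (hr t))
  obtain ⟨g, hgdef⟩ : ∃ g : ℕ → Params d,
      ∀ t, g t = couplingOp (‖r t‖⁻¹ • r t) (‖W t‖⁻¹ • W t) := ⟨_, fun _ => rfl⟩
  have hg : Tendsto g atTop (𝓝 (couplingOp z u)) :=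
    ((continuous_couplingOp.tendsto (z, u)).comp (hz.prodMk_nhds hu)).congr fun t => (hgdef t).symm
  have hWg : ∀ t, W (t + 1) = W t + (η t * ‖r t‖ * ‖W t‖) • g t := by
    intro t
    rw [hW, hgdef, map_smul, couplingOp_smul_left, smul_smul, smul_smul]
    rcases eq_or_ne (W t) 0 with h | h
    · simp [h]
    · have h1 := norm_ne_zero_iff.2 h
      have h2 := norm_ne_zero_iff.2 (hr t)
      congr 2
      field_simp
  have hlam := eq_norm_smul_of_tendstoInDirection
    (fun t => mul_nonneg (hτ t).le (norm_nonneg _)) hWg hg htop hu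
  obtain ⟨l, hl⟩ : ∃ l, l = ‖couplingOp z u‖ := ⟨_, rfl⟩
  rw [← hl] at hlam
  refine ⟨l, hlam, fun k => ?_⟩
  have hl0 : 0 ≤ l := hl ▸ norm_nonneg _
  have hgn : Tendsto (fun t => ‖g t‖) atTop (𝓝 l) := hl ▸ hg.norm
  have hWn : ∀ t, ‖W (t + 1)‖ ≤ (1 + η t * ‖r t‖ * ‖g t‖) * ‖W t‖ := fun t => by
    rw [hWg]
    refine (norm_add_le _ _).trans_eq ?_
    rw [norm_smul, Real.norm_of_nonneg (mul_nonneg (hτ t).le (norm_nonneg _))]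
    ring
  have hsum : Tendsto (fun n => ∑ t ∈ Finset.range n, η t * ‖r t‖) atTop atTop := by
    obtain ⟨C, hC⟩ := hgn.bddAbove_range
    have hC0 : 0 ≤ C := (norm_nonneg (g 0)).trans (hC ⟨0, rfl⟩)
    refine tendsto_sum_of_growth (fun t => (hτ t).le) hC0 (fun t => norm_nonneg (W t))
      (fun t => (hWn t).trans ?_) htop
    have := mul_le_mul_of_nonneg_left (hC ⟨t, rfl⟩) (hτ t).le
    exact mul_le_mul_of_nonneg_right (by simpa using this) (norm_nonneg _)
  by_contra! hcon
  obtain ⟨κ', h1, h2⟩ := exists_between hcon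
  obtain ⟨κ, h3, h4⟩ := exists_between h2
  have hκ' : 0 < κ' := hl0.trans_lt h1
  have hκ : 0 < κ := hκ'.trans h3
  obtain ⟨p, T, hpW, hpos, hgrow⟩ :=
    exists_growth_frequency hη hW hlt hr hz hsum (h0 k) hκ h4
  have hrn : ∀ᶠ t in atTop, κ < ‖fourier (‖r t‖⁻¹ • r t) k‖ :=
    ((((continuous_apply k).comp continuous_fourier).tendsto z).comp hz).norm.eventually_const_lt h4
  obtain ⟨T', hT'⟩ := eventually_atTop.1 ((hrn.and (hgn.eventually_lt_const h1)).and
    ((htop.eventually_gt_atTop 0).and (eventually_ge_atTop T)))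
  have hratio : ∀ t ≥ T', (1 + (κ - κ') / 2 * (η t * ‖r t‖)) * (p t / ‖W t‖)
      ≤ p (t + 1) / ‖W (t + 1)‖ := by
    intro t ht
    obtain ⟨⟨h5, h6⟩, h7, h8⟩ := hT' t ht
    have h9 := (hT' (t + 1) (by omega)).2.1
    have hτt := hτ t
    -- admissibility bounds the normalized steps
    have hτκ : η t * ‖r t‖ * κ < 1 := by
      have h10 : η t * ‖r t‖ * ‖fourier (‖r t‖⁻¹ • r t) k‖ = η t * ‖fourier (r t) k‖ := by
        have := norm_ne_zero_iff.2 (hr t)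
        rw [fourier_smul, Pi.smul_apply, norm_smul, Complex.norm_real, norm_inv, norm_norm]
        field_simp
      have := mul_le_mul_of_nonneg_left h5.le hτt.le
      linarith [hlt t k]
    have h10 := hgrow t h8
    have hpt := hpos t h8
    have hWt := hWn t
    generalize η t * ‖r t‖ = s at *
    have h11 : ‖W (t + 1)‖ ≤ (1 + s * κ') * ‖W t‖ :=
      hWt.trans (mul_le_mul_of_nonneg_right
        (by have := mul_le_mul_of_nonneg_left h6.le hτt.le; linarith) h7.le)
    have h14 : 0 ≤ (κ - κ') / 2 * s := mul_nonneg (by linarith) hτt.le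
    have h12 : (1 + (κ - κ') / 2 * s) * (1 + s * κ') ≤ 1 + κ * s := by
      have h13 : s * κ' ≤ 1 := (mul_le_mul_of_nonneg_left h3.le hτt.le).trans hτκ.le
      linarith [mul_le_mul_of_nonneg_left h13 h14]
    rw [mul_div_assoc', div_le_div_iff₀ h7 h9]
    calc (1 + (κ - κ') / 2 * s) * p t * ‖W (t + 1)‖
        ≤ (1 + (κ - κ') / 2 * s) * p t * ((1 + s * κ') * ‖W t‖) :=
          mul_le_mul_of_nonneg_left h11 (mul_nonneg (by linarith) hpt.le)
      _ = ((1 + (κ - κ') / 2 * s) * (1 + s * κ')) * (p t * ‖W t‖) := by ring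
      _ ≤ (1 + κ * s) * (p t * ‖W t‖) :=
          mul_le_mul_of_nonneg_right h12 (mul_pos hpt h7).le
      _ = (1 + κ * s) * p t * ‖W t‖ := by ring
      _ ≤ p (t + 1) * ‖W t‖ := mul_le_mul_of_nonneg_right h10 h7.le
  obtain ⟨t, ht, h5⟩ := exists_lt_of_growth (fun t => (hτ t).le) hsum (by linarith)
    (div_pos (hpos _ (hT' T' le_rfl).2.2) (hT' T' le_rfl).2.1) hratio 2
  have h6 := (hT' t ht).2.1
  rw [lt_div_iff₀ h6] at h5
  exact h5.not_ge (hpW t)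

/-! ### The limit of the residuals is supported on the support vectors -/

theorem convNet_sum_smul {n : ℕ} (W : Params d) (c : Fin n → ℝ) (x : Fin n → Vec d) :
    convNet W (∑ i, c i • x i) = ∑ i, c i * convNet W (x i) := by
  simp_rw [convNet_eq_inner_predictor, inner_sum, real_inner_smul_right]

theorem lossWeight_pos {n : ℕ} [NeZero n] (x : Fin n → Vec d) (y : Fin n → ℝ) (W : Params d)
    (i : Fin n) : 0 < lossWeight x y W i := by
  have : (0 : ℝ) < n := Nat.cast_pos.2 (NeZero.pos n)
  rw [lossWeight]; positivity

/-- Separability bounds the loss weights by the norm of the residual. -/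
theorem exists_lossWeight_le {n : ℕ} [NeZero n] {x : Fin n → Vec d} {y : Fin n → ℝ} {u : Params d}
    (hu : ∀ i, 0 < y i * convNet u (x i)) :
    ∃ C, ∀ W i, lossWeight x y W i ≤ C * ‖residual x y W‖ := by
  obtain ⟨i₀, hi₀⟩ := Finite.exists_min fun i => y i * convNet u (x i)
  refine ⟨‖predictor u‖ / (y i₀ * convNet u (x i₀)), fun W i => ?_⟩
  rw [div_mul_eq_mul_div, le_div_iff₀ (hu i₀)]
  have h1 : lossWeight x y W i * (y i₀ * convNet u (x i₀)) ≤ convNet u (residual x y W) := by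
    rw [residual, convNet_sum_smul]
    calc lossWeight x y W i * (y i₀ * convNet u (x i₀))
        ≤ lossWeight x y W i * (y i * convNet u (x i)) :=
          mul_le_mul_of_nonneg_left (hi₀ i) (lossWeight_pos x y W i).le
      _ = lossWeight x y W i * y i * convNet u (x i) := by ring
      _ ≤ _ := Finset.single_le_sum (f := fun i => lossWeight x y W i * y i * convNet u (x i))
          (fun j _ => by
            rw [mul_assoc]; exact mul_nonneg (lossWeight_pos x y W j).le (hu j).le)
          (Finset.mem_univ i)
  rw [convNet_eq_inner_predictor u (residual x y W)] at h1
  exact h1.trans (real_inner_le_norm _ _)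

/-- The limit direction of the residuals is a nonnegative combination of the signed support vectors of
the limit direction of the parameters, because the other exponential losses are negligible. -/
theorem exists_eq_sum_support {n : ℕ} [NeZero n] {x : Fin n → Vec d} {y : Fin n → ℝ}
    {W : ℕ → Params d} {u : Params d} {z : Vec d} (hu : TendstoInDirection W u)
    (htop : Tendsto (fun t => ‖W t‖) atTop atTop) (hpos : ∀ i, 0 < y i * convNet u (x i))
    (hr : ∀ t, residual x y (W t) ≠ 0)
    (hz : TendstoInDirection (fun t => residual x y (W t)) z) :
    ∃ α : Fin n → ℝ, (∀ i, 0 ≤ α i) ∧ z = ∑ i, (α i * y i) • x i ∧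
      ∀ i j, y j * convNet u (x j) < y i * convNet u (x i) → α i = 0 := by
  obtain ⟨C, hC⟩ := exists_lossWeight_le hpos
  set A : ℕ → Fin n → ℝ := fun t i => lossWeight x y (W t) i / ‖residual x y (W t)‖ with hA
  have hA0 : ∀ t i, 0 ≤ A t i := fun t i =>
    div_nonneg (lossWeight_pos x y _ i).le (norm_nonneg _)
  have hAC : ∀ t i, A t i ≤ C := fun t i => by
    rw [hA, div_le_iff₀ (norm_pos_iff.2 (hr t))]
    exact hC _ _
  obtain ⟨α, hα, s, hs, hlim⟩ := (isCompact_Icc (a := (0 : Fin n → ℝ)) (b := fun _ => C)).tendsto_subseq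
    (x := A) fun t => ⟨fun i => hA0 t i, fun i => hAC t i⟩
  have hlimi : ∀ i, Tendsto (fun t => A (s t) i) atTop (𝓝 (α i)) := fun i =>
    (tendsto_pi_nhds.1 hlim) i
  refine ⟨α, fun i => hα.1 i, ?_, fun i j hij => ?_⟩
  · have h1 : Tendsto (fun t => ∑ i, (A (s t) i * y i) • x i) atTop
        (𝓝 (∑ i, (α i * y i) • x i)) :=
      tendsto_finsetSum _ fun i _ => ((hlimi i).mul_const (y i)).smul_const (x i)
    refine tendsto_nhds_unique (hz.comp hs.tendsto_atTop) (h1.congr fun t => ?_)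
    simp only [Function.comp_apply, residual, Finset.smul_sum, smul_smul, hA]
    refine Finset.sum_congr rfl fun i _ => ?_
    congr 1
    ring
  · have hmar : ∀ i, Tendsto (fun t => y i * convNet (‖W t‖⁻¹ • W t) (x i)) atTop
        (𝓝 (y i * convNet u (x i))) := fun i =>
      (((continuous_convNet (x i)).tendsto u).comp hu).const_mul (y i)
    have hexp : Tendsto (fun t => Real.exp (-(‖W t‖ ^ 2 *
        (y i * convNet (‖W t‖⁻¹ • W t) (x i) - y j * convNet (‖W t‖⁻¹ • W t) (x j)))))
        atTop (𝓝 0) := by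
      have h1 : Tendsto (fun t => ‖W t‖ ^ 2) atTop atTop :=
        (tendsto_pow_atTop two_ne_zero).comp htop
      have h2 := h1.atTop_mul_pos (sub_pos.2 hij) ((hmar i).sub (hmar j))
      exact Real.tendsto_exp_neg_atTop_nhds_zero.comp h2
    have hle : ∀ᶠ t in atTop, A t i ≤ C * Real.exp (-(‖W t‖ ^ 2 *
        (y i * convNet (‖W t‖⁻¹ • W t) (x i) - y j * convNet (‖W t‖⁻¹ • W t) (x j)))) := by
      filter_upwards [htop.eventually_gt_atTop 0] with t ht
      have h1 : A t i = A t j * Real.exp (-(‖W t‖ ^ 2 *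
          (y i * convNet (‖W t‖⁻¹ • W t) (x i) - y j * convNet (‖W t‖⁻¹ • W t) (x j)))) := by
        simp only [hA, lossWeight, convNet_smul]
        have h2 : ‖W t‖ ^ 2 * ‖W t‖⁻¹ ^ 2 = 1 := by field_simp
        have h3 : Real.exp (-(y i * convNet (W t) (x i))) = Real.exp (-(y j * convNet (W t) (x j)))
            * Real.exp (-(‖W t‖ ^ 2 * (y i * (‖W t‖⁻¹ ^ 2 * convNet (W t) (x i))
              - y j * (‖W t‖⁻¹ ^ 2 * convNet (W t) (x j))))) := by
          rw [← Real.exp_add]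
          congr 1
          linear_combination (y i * convNet (W t) (x i) - y j * convNet (W t) (x j)) * h2
        rw [h3]
        ring
      rw [h1]
      exact mul_le_mul_of_nonneg_right (hAC t j) (Real.exp_pos _).le
    have h2 : Tendsto (fun t => A t i) atTop (𝓝 0) :=
      tendsto_of_tendsto_of_tendsto_of_le_of_le' tendsto_const_nhds
        (by simpa using hexp.const_mul C) (Eventually.of_forall fun t => hA0 t i) hle
    exact tendsto_nhds_unique (hlimi i) (h2.comp hs.tendsto_atTop)

/-! ### Robustness radii -/

/-- The optimality conditions certify maximal robustness. The radius of the normalized network `u` is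
at least twice its margin `γ`, by duality of the Fourier `ℓ_∞` and `ℓ₁` norms; the perturbations
`∓(ε / l) • z` show that no network has a larger radius. -/
theorem isMaximallyRobust_of_certificate {n : ℕ} {x : Fin n → Vec d} {y : Fin n → ℝ}
    (hy : ∀ i, y i = 1 ∨ y i = -1) {u : Params d} (hu : ‖u‖ = 1) {γ l : ℝ} (hγ : 0 < γ)
    (hmar : ∀ i, γ ≤ y i * convNet u (x i)) {α : Fin n → ℝ} (hα : ∀ i, 0 ≤ α i)
    (hA : 0 < ∑ i, α i) (hl : l = 2 * γ * ∑ i, α i)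
    (hz : ∀ k, ‖fourier (∑ i, (α i * y i) • x i) k‖ ≤ l) :
    IsMaximallyRobust (convNets d) x y (convNet u) := by
  have hy1 : ∀ i, |y i| = 1 := fun i => by rcases hy i with h | h <;> simp [h]
  have hyy : ∀ i, y i * y i = 1 := fun i => by rcases hy i with h | h <;> simp [h]
  have hl0 : 0 < l := by rw [hl]; positivity
  refine ⟨⟨u, rfl⟩, fun i => hγ.trans_le (hmar i), ?_⟩
  set z := ∑ i, (α i * y i) • x i with hzdef
  have hzn : ‖fourier z‖ ≤ l := (pi_norm_le_iff_of_nonneg hl0.le).2 hz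
  rintro _ ⟨V, rfl⟩
  have hupper : robustRadius x y (convNet V) ≤ ENNReal.ofReal (2 * γ) := by
    refine iSup₂_le fun ε hε => ?_
    rw [← ENNReal.ofReal_coe_nnreal]
    refine ENNReal.ofReal_le_ofReal ?_
    obtain ⟨i₀, hi₀⟩ : ∃ i, 0 < α i := by
      by_contra! h
      exact hA.not_ge (Finset.sum_nonpos fun i _ => h i)
    have hVz : convNet V z = ∑ i, α i * (y i * convNet V (x i)) := by
      rw [hzdef, convNet_sum_smul]
      exact Finset.sum_congr rfl fun i _ => by ring
    have hcorr : ∀ i, 0 < y i * convNet V (x i) := fun i => by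
      have h := hε i 0 (by
        have : fourier (0 : Vec d) = 0 := by simpa using fourier_smul 0 (0 : Vec d)
        rw [this, norm_zero]; exact ε.2)
      rwa [add_zero] at h
    have hVz0 : 0 < convNet V z := by
      rw [hVz]
      exact Finset.sum_pos' (fun i _ => mul_nonneg (hα i) (hcorr i).le)
        ⟨i₀, Finset.mem_univ _, mul_pos hi₀ (hcorr i₀)⟩
    have hpert : ∀ i, 0 < y i * convNet V (x i) - ε / l * convNet V z := fun i => by
      have h := hε i ((-(y i * (ε / l))) • z) (by
        rw [fourier_smul, norm_smul, Complex.norm_real, Real.norm_eq_abs, abs_neg, abs_mul, hy1,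
          one_mul, abs_of_nonneg (by positivity), div_mul_eq_mul_div, div_le_iff₀ hl0]
        exact mul_le_mul_of_nonneg_left hzn ε.2)
      rw [convNet_input_add, convNet_input_smul] at h
      linear_combination h - (ε / l * convNet V z) * hyy i
    have hsum : 0 < ∑ i, α i * (y i * convNet V (x i) - ε / l * convNet V z) :=
      Finset.sum_pos' (fun i _ => mul_nonneg (hα i) (hpert i).le)
        ⟨i₀, Finset.mem_univ _, mul_pos hi₀ (hpert i₀)⟩
    simp only [mul_sub, Finset.sum_sub_distrib, ← hVz, ← Finset.sum_mul] at hsum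
    have h1 : (∑ i, α i) * (ε / l) < 1 := by
      by_contra! h
      nlinarith
    rw [mul_div_assoc', div_lt_one hl0, hl] at h1
    nlinarith
  refine hupper.trans (le_of_forall_lt fun c hc => ?_)
  lift c to ℝ≥0 using hc.ne_top
  obtain ⟨ε, hcε, hε⟩ := ENNReal.lt_iff_exists_nnreal_btwn.1 hc
  refine lt_of_lt_of_le hcε (le_iSup₂_of_le ε (fun i δ hδ => ?_) le_rfl)
  have hε2 : (ε : ℝ) < 2 * γ := by
    rw [← ENNReal.ofReal_coe_nnreal] at hε
    exact (ENNReal.ofReal_lt_ofReal_iff (by positivity)).1 hε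
  have h1 := abs_convNet_le u δ
  rw [hu] at h1
  have h2 : |y i * convNet u δ| ≤ ‖fourier δ‖ * (1 ^ 2 / 2) := by rwa [abs_mul, hy1, one_mul]
  rw [convNet_input_add, mul_add]
  linarith [neg_le_of_abs_le h2, hmar i]

theorem robustRadius_const_mul {n : ℕ} (x : Fin n → Vec d) (y : Fin n → ℝ) (φ : Vec d → ℝ) {c : ℝ}
    (hc : 0 < c) : robustRadius x y (fun z => c * φ z) = robustRadius x y φ := by
  have h (ε : ℝ≥0) : IsRobust x y (fun z => c * φ z) ε ↔ IsRobust x y φ ε := by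
    simp only [IsRobust, mul_left_comm _ c, mul_pos_iff_of_pos_left hc]
  simp only [robustRadius, h]

theorem IsMaximallyRobust.const_mul {n : ℕ} {x : Fin n → Vec d} {y : Fin n → ℝ} {φ : Vec d → ℝ}
    (h : IsMaximallyRobust (convNets d) x y φ) {c : ℝ} (hc : 0 < c) :
    IsMaximallyRobust (convNets d) x y fun z => c * φ z := by
  refine ⟨?_, fun i => ?_, fun ψ hψ => ?_⟩
  · obtain ⟨W, rfl⟩ := h.mem
    refine ⟨√c • W, funext fun z => ?_⟩
    rw [convNet_smul, Real.sq_sqrt hc.le]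
  · rw [mul_left_comm]; exact mul_pos hc (h.correct i)
  · rw [robustRadius_const_mul x y φ hc]; exact h.le_radius ψ hψ

/-! ### Limits of gradient descent -/

theorem tendsto_norm_atTop_of_netRisk {n : ℕ} [NeZero n] {x : Fin n → Vec d} {y : Fin n → ℝ}
    {W : ℕ → Params d} (h : Tendsto (fun t => netRisk x y (W t)) atTop (𝓝 0)) :
    Tendsto (fun t => ‖W t‖) atTop atTop := by
  have hn : (0 : ℝ) < n := Nat.cast_pos.2 (NeZero.pos n)
  have h1 : Tendsto (fun t => Real.exp (-(y 0 * convNet (W t) (x 0)))) atTop (𝓝 0) := by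
    refine squeeze_zero (fun t => (Real.exp_pos _).le) (fun t => ?_)
      (by simpa using h.const_mul (n : ℝ))
    rw [netRisk, ← mul_assoc, mul_one_div_cancel hn.ne', one_mul]
    exact Finset.single_le_sum (f := fun i => Real.exp (-(y i * convNet (W t) (x i))))
      (fun i _ => (Real.exp_pos _).le) (Finset.mem_univ 0)
  have h2 := tendsto_neg_atBot_iff.1 (Real.tendsto_exp_comp_nhds_zero.1 h1)
  set C := |y 0| * (‖fourier (x 0)‖ / 2) + 1 with hC
  have hC0 : 0 < C := by positivity
  have h3 : Tendsto (fun t => C * ‖W t‖ ^ 2) atTop atTop := by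
    refine tendsto_atTop_mono (fun t => ?_) h2
    refine (le_abs_self _).trans ?_
    rw [abs_mul]
    have := mul_le_mul_of_nonneg_left (abs_convNet_le (W t) (x 0)) (abs_nonneg (y 0))
    nlinarith [sq_nonneg ‖W t‖]
  have h4 := Real.tendsto_sqrt_atTop.comp ((tendsto_const_mul_atTop_of_pos hC0).1 h3)
  refine h4.congr fun t => ?_
  simp

theorem residual_ne_zero {n : ℕ} [NeZero n] {x : Fin n → Vec d} {y : Fin n → ℝ} {u : Params d}
    (hu : ∀ i, 0 < y i * convNet u (x i)) (W : Params d) : residual x y W ≠ 0 := by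
  obtain ⟨C, hC⟩ := exists_lossWeight_le hu
  intro h
  have h1 := hC W 0
  rw [h, norm_zero, mul_zero] at h1
  exact h1.not_gt (lossWeight_pos x y W 0)

theorem predictor_smul (c : ℝ) (W : Params d) : predictor (c • W) = c ^ 2 • predictor W :=
  ext_inner_right ℝ fun z => by
    rw [← convNet_eq_inner_predictor, convNet_smul, real_inner_smul_left,
      convNet_eq_inner_predictor]

theorem continuous_predictor : Continuous (predictor (d := d)) := by
  refine (PiLp.continuous_toLp 2 _).comp (continuous_pi fun j => ?_)
  simp only [layer]
  fun_prop

theorem tendstoInDirection_predictor {W : ℕ → Params d} {u : Params d}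
    (htop : Tendsto (fun t => ‖W t‖) atTop atTop) (hu : TendstoInDirection W u)
    (hne : predictor u ≠ 0) :
    TendstoInDirection (fun t => predictor (W t)) (‖predictor u‖⁻¹ • predictor u) := by
  have h1 : Tendsto (fun t => predictor (‖W t‖⁻¹ • W t)) atTop (𝓝 (predictor u)) :=
    (continuous_predictor.tendsto u).comp hu
  refine ((h1.norm.inv₀ (norm_ne_zero_iff.2 hne)).smul h1).congr' ?_
  filter_upwards [htop.eventually_gt_atTop 0] with t ht
  have h2 : 0 < ‖W t‖⁻¹ ^ 2 := by positivity
  rw [predictor_smul, norm_smul, Real.norm_of_nonneg h2.le, smul_smul, mul_inv,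
    mul_right_comm, inv_mul_cancel₀ h2.ne', one_mul]

end ConvNet

theorem corollary2 (d n : ℕ) [NeZero d] [NeZero n] (y : Fin n → ℝ)
    (hy : ∀ i, y i = 1 ∨ y i = -1) :
    ∀ᵐ x : Fin n → ConvNet.Vec d, ConvNet.LinearlySeparable x y →
      ∀ᵐ W₀ : ConvNet.Params d,
        ∀ (η : ℕ → ℝ) (W : ℕ → ConvNet.Params d),
          W 0 = W₀ →
          ConvNet.IsGradientDescent (ConvNet.netRisk x y) η W →
          (∀ t, ConvNet.IsAdmissibleStep (ConvNet.netRisk x y) (η t) (W t)) →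
          Tendsto (fun t => ConvNet.netRisk x y (W t)) atTop (𝓝 0) →
          ∀ Winf : ConvNet.Params d,
            ConvNet.TendstoInDirection W Winf →
            (∀ i, 0 < y i * ConvNet.convNet Winf (x i)) →
            (∃ g : ConvNet.Vec d, ConvNet.TendstoInDirection
              (fun t => gradient (ConvNet.linRisk x y) (ConvNet.predictor (W t))) g) →
            ConvNet.IsMaximallyRobust (ConvNet.convNets d) x y (ConvNet.convNet Winf) ∧
            ∃ v : ConvNet.Vec d,
              ConvNet.TendstoInDirection (fun t => ConvNet.predictor (W t)) v ∧
              ConvNet.IsMaximallyRobust (ConvNet.convNets d) x y (fun z => inner ℝ v z) := by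
  refine Eventually.of_forall fun x _ => ?_
  filter_upwards [ConvNet.ae_norm_fourier_layer_ne] with W₀ hW₀ η W h0 hgd hstep hrisk u hu hpos hg
  obtain ⟨g, hg⟩ := hg
  have htop := ConvNet.tendsto_norm_atTop_of_netRisk hrisk
  have hr : ∀ t, ConvNet.residual x y (W t) ≠ 0 := fun t => ConvNet.residual_ne_zero hpos (W t)
  have hz : ConvNet.TendstoInDirection (fun t => ConvNet.residual x y (W t)) (-g) := by
    refine (Tendsto.neg hg).congr fun t => ?_
    beta_reduce
    rw [ConvNet.gradient_linRisk, norm_neg, smul_neg, neg_neg]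
  have hun : ‖u‖ = 1 := by
    refine tendsto_nhds_unique (Tendsto.norm hu) (tendsto_const_nhds.congr' ?_)
    filter_upwards [htop.eventually_gt_atTop 0] with t ht
    rw [norm_smul, norm_inv, norm_norm, inv_mul_cancel₀ ht.ne']
  have hzn : ‖-g‖ = 1 := by
    refine tendsto_nhds_unique (Tendsto.norm hz) (tendsto_const_nhds.congr fun t => ?_)
    rw [norm_smul, norm_inv, norm_norm, inv_mul_cancel₀ (norm_ne_zero_iff.2 (hr t))]
  obtain ⟨l, hl, hle⟩ := ConvNet.exists_couplingOp_eq_smul (fun t => (hstep t).1)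
    (fun t => by rw [hgd t, ConvNet.gradient_netRisk, smul_neg, sub_neg_eq_add])
    (fun t k => (hstep t).mul_norm_fourier_lt_one k) hr htop hu hz (by rw [h0]; exact hW₀)
  obtain ⟨α, hα, hzα, hsupp⟩ := ConvNet.exists_eq_sum_support hu htop hpos hr hz
  obtain ⟨i₀, hi₀⟩ := Finite.exists_min fun i => y i * ConvNet.convNet u (x i)
  set γ := y i₀ * ConvNet.convNet u (x i₀) with hγ
  have hA : 0 < ∑ i, α i := by
    refine lt_of_le_of_ne (Finset.sum_nonneg fun i _ => hα i) fun h => ?_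
    have h1 := (Finset.sum_eq_zero_iff_of_nonneg fun i _ => hα i).1 h.symm
    rw [hzα, Finset.sum_eq_zero fun i hi => by rw [h1 i hi, zero_mul, zero_smul], norm_zero] at hzn
    exact zero_ne_one hzn
  -- complementary slackness: both sides are `2 * convNet u (-g)`
  have hlγ : l = 2 * γ * ∑ i, α i := by
    have h1 := ConvNet.inner_self_couplingOp (-g) u
    rw [hl, real_inner_smul_right, real_inner_self_eq_norm_sq, hun, hzα,
      ConvNet.convNet_sum_smul] at h1
    have h2 : ∑ i, α i * y i * ConvNet.convNet u (x i) = γ * ∑ i, α i := by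
      rw [Finset.mul_sum]
      refine Finset.sum_congr rfl fun i _ => ?_
      rcases (hi₀ i).eq_or_lt with h | h
      · rw [mul_assoc, ← h, mul_comm]
      · rw [hsupp i i₀ h]; ring
    rw [h2] at h1
    linarith
  have hmax : ConvNet.IsMaximallyRobust (ConvNet.convNets d) x y (ConvNet.convNet u) :=
    ConvNet.isMaximallyRobust_of_certificate hy hun (hpos i₀) hi₀ hα hA hlγ
      (by rw [← hzα]; exact hle)
  have hne : ConvNet.predictor u ≠ 0 := fun h => by
    have h1 := hpos i₀
    rw [ConvNet.convNet_eq_inner_predictor, h, inner_zero_left, mul_zero] at h1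
    exact h1.false
  refine ⟨hmax, _, ConvNet.tendstoInDirection_predictor htop hu hne, ?_⟩
  have h1 := hmax.const_mul (inv_pos.2 (norm_pos_iff.2 hne))
  simp only [ConvNet.convNet_eq_inner_predictor, ← real_inner_smul_left] at h1
  exact h1
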